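/- **Conventions.** Let $I=(0,1]$. A net $(a_\varepsilon)_{\varepsilon\in I}$ of real numbers is *moderate* if $|a_\varepsilon|=O(\varepsilon^{-N})$ as $\varepsilon\to0$ for some $N\in\mathbb N$, and *negligible* if $|a_\varepsilon|=O(\varepsilon^{m})$ for every $m\in\mathbb N$. The ring $\widetilde{\mathbb R}$ of generalized numbers is the quotient of the ring of moderate nets by the ideal of negligible nets. A number $a\in\widetilde{\mathbb R}$ is *strictly positive* if it has a representative with $a_\varepsilon\ge\varepsilon^m$ for some $m\ge 0$ and all small $\varepsilon$, and *strictly negative* if $-a$ is strictly positive. *Index of a form.* Let $A$ be a symmetric $n\times n$ matrix over $\widetilde{\mathbb R}$. Its generalized eigenvalues $\lambda_1,\dots,\lambda_n\in\widetilde{\mathbb R}$ are the classes of the nets of ordered eigenvalues $\lambda_{1,\varepsilon}\ge\dots\ge\lambda_{n,\varepsilon}$ of a symmetric representative $(A_\varepsilon)_\varepsilon$ of $A$ (they do not depend on the choice of the representative). The matrix $A$ has index $j$ if every one of the $n$ eigenvalues, counted with multiplicity, is strictly positive or strictly negative and exactly $j$ of them are strictly negative. A symmetric bilinear form $b$ on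 $\widetilde{\mathbb R}^n$ has index $j$ if, for some basis $(e_1,\dots,e_n)$ of $\widetilde{\mathbb R}^n$, the matrix $(b(e_i,e_k))_{i,k}$ has index $j$. *Generalized tensors.* Let $X$ be a paracompact smooth Hausdorff manifold of dimension $n$; charts $(V_\alpha,\psi_\alpha)$ are those of its maximal smooth atlas. A net $(g_\varepsilon)_{\varepsilon\in I}$ of smooth $(0,2)$-tensor fields on $X$ is *moderate* if in each chart, for each component $g^{\varepsilon}_{\alpha,ik}$, each compact $K\subset\psi_\alpha(V_\alpha)$ and each order $k'$, the derivatives of order $k'$ are $O(\varepsilon^{-N})$ uniformly on $K$ for some $N$; it is *negligible* if they are $O(\varepsilon^m)$ uniformly on $K$ for every $m$. The quotient of the moderate nets by the negligible nets is denoted $\mathcal G^0_2(X)$. *Point values.* For an open $\Omega\subset\mathbb R^n$, $\Omega_c^\sim$ is the set of nets $(x_\varepsilon)_{\varepsilon\in I}$ of points of $\Omega$ that lie in a fixed compact subset of $\Omega$ for all small $\varepsilon$, modulo the relation $|x_\varepsilon-y_\varepsilon|=O(\varepsilon^m)$ for all $m$. For $g\in\mathcal G^0_2(X)$ and $\widetilde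 x\in(\psi_\alpha(V_\alpha))_c^\sim$, $g_\alpha(\widetilde x)$ is the bilinear form on $\widetilde{\mathbb R}^n$ whose coefficients with respect to the canonical basis are the classes of the nets $(g^{\varepsilon}_{\alpha,ik}(x_\varepsilon))_\varepsilon$ (this does not depend on the representatives). We call $g$ *symmetric and non-degenerate* if for each chart $(V_\alpha,\psi_\alpha)$ and each $\widetilde x\in(\psi_\alpha(V_\alpha))_c^\sim$ the form $g_\alpha(\widetilde x)$ is symmetric and non-degenerate. We say that such a $g$ *has (constant) index* $j$ if for each relatively compact open set $V\subset X$ there are a representative $(g_\varepsilon)_\varepsilon$ of $g$ and $\varepsilon_0>0$ such that for all $\varepsilon<\varepsilon_0$ the restriction $g_\varepsilon|_V$ is a smooth pseudo-Riemannian metric whose index (the maximal dimension of a negative definite subspace of the tangent space) is $j$ at each point of $V$. **Theorem.** Let $g\in\mathcal G^0_2(X)$ be symmetric and non-degenerate and let $j\in\mathbb N_0$. The following are equivalent: 1. $g$ has (constant) index $j$. 2. For each chart $(V_\alpha,\psi_\alpha)$ and each $\widetilde x\in(\psi_\alpha(V_\alpha))_c^\sim$, $g_\alpha(\widetilde x)$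 is a symmetric bilinear form on $\widetilde{\mathbb R}^n$ with index $j$. -/

import Mathlib

open scoped Manifold ContDiff Topology Bundle

noncomputable section

namespace Colombeau

/-! ### Nets and generalized real numbers -/

/-- The index set `(0, 1]` of the smoothing parameter `ε`. -/
abbrev Idx : Type := Set.Ioc (0 : ℝ) 1

/-- The filter `ε → 0` on `(0, 1]`. -/
def toZero : Filter Idx := Filter.comap Subtype.val (𝓝 (0 : ℝ))

/-- Moderate nets of numbers: `|x ε| = O(ε ^ (-N))` for some `N`. -/
def IsModerate (x : Idx → ℝ) : Prop :=
  ∃ (N : ℕ) (C : ℝ), ∀ᶠ ε in toZero, |x ε| ≤ C * ((ε : ℝ)⁻¹) ^ N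

/-- Negligible nets of numbers: `|x ε| = O(ε ^ m)` for every `m`. -/
def IsNegligible (x : Idx → ℝ) : Prop :=
  ∀ m : ℕ, ∃ C : ℝ, ∀ᶠ ε in toZero, |x ε| ≤ C * (ε : ℝ) ^ m

theorem one_le_inv_pow (ε : Idx) (N : ℕ) : 1 ≤ ((ε : ℝ)⁻¹) ^ N :=
  one_le_pow₀ ((one_le_inv₀ ε.2.1).2 ε.2.2)

theorem inv_pow_mono (ε : Idx) {N M : ℕ} (h : N ≤ M) : ((ε : ℝ)⁻¹) ^ N ≤ ((ε : ℝ)⁻¹) ^ M :=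
  pow_le_pow_right₀ ((one_le_inv₀ ε.2.1).2 ε.2.2) h

theorem bound_add {a b C D : ℝ} (ε : Idx) (N M : ℕ)
    (ha : a ≤ C * ((ε : ℝ)⁻¹) ^ N) (hb : b ≤ D * ((ε : ℝ)⁻¹) ^ M) :
    a + b ≤ (|C| + |D|) * ((ε : ℝ)⁻¹) ^ (N + M) := by
  have h1 := inv_pow_mono ε (Nat.le_add_right N M)
  have h2 := inv_pow_mono ε (Nat.le_add_left M N)
  have p1 : (0 : ℝ) ≤ ((ε : ℝ)⁻¹) ^ N := zero_le_one.trans (one_le_inv_pow ε N)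
  have p2 : (0 : ℝ) ≤ ((ε : ℝ)⁻¹) ^ M := zero_le_one.trans (one_le_inv_pow ε M)
  have h3 : C * ((ε : ℝ)⁻¹) ^ N ≤ |C| * ((ε : ℝ)⁻¹) ^ (N + M) :=
    (mul_le_mul_of_nonneg_right (le_abs_self C) p1).trans
      (mul_le_mul_of_nonneg_left h1 (abs_nonneg C))
  have h4 : D * ((ε : ℝ)⁻¹) ^ M ≤ |D| * ((ε : ℝ)⁻¹) ^ (N + M) :=
    (mul_le_mul_of_nonneg_right (le_abs_self D) p2).trans
      (mul_le_mul_of_nonneg_left h2 (abs_nonneg D))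
  linarith

theorem IsModerate.add {x y : Idx → ℝ} (hx : IsModerate x) (hy : IsModerate y) :
    IsModerate (x + y) := by
  obtain ⟨N, C, h⟩ := hx
  obtain ⟨M, D, h'⟩ := hy
  refine ⟨N + M, |C| + |D|, ?_⟩
  filter_upwards [h, h'] with ε h1 h2
  exact (abs_add_le _ _).trans (bound_add ε N M h1 h2)

theorem IsModerate.mul {x y : Idx → ℝ} (hx : IsModerate x) (hy : IsModerate y) :
    IsModerate (x * y) := by
  obtain ⟨N, C, h⟩ := hx
  obtain ⟨M, D, h'⟩ := hy
  refine ⟨N + M, C * D, ?_⟩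
  filter_upwards [h, h'] with ε h1 h2
  rw [Pi.mul_apply, abs_mul, pow_add]
  calc |x ε| * |y ε| ≤ (C * ((ε : ℝ)⁻¹) ^ N) * (D * ((ε : ℝ)⁻¹) ^ M) :=
        mul_le_mul h1 h2 (abs_nonneg _) ((abs_nonneg _).trans h1)
    _ = _ := by ring

theorem IsModerate.neg {x : Idx → ℝ} (hx : IsModerate x) : IsModerate (-x) := by
  obtain ⟨N, C, h⟩ := hx
  exact ⟨N, C, by simpa only [Pi.neg_apply, abs_neg] using h⟩

theorem isModerate_const (c : ℝ) : IsModerate fun _ => c :=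
  ⟨0, |c|, Filter.Eventually.of_forall fun ε => by simp⟩

theorem IsNegligible.add {x y : Idx → ℝ} (hx : IsNegligible x) (hy : IsNegligible y) :
    IsNegligible (x + y) := by
  intro m
  obtain ⟨C, h⟩ := hx m
  obtain ⟨D, h'⟩ := hy m
  refine ⟨C + D, ?_⟩
  filter_upwards [h, h'] with ε h1 h2
  rw [add_mul]
  exact (abs_add_le _ _).trans (add_le_add h1 h2)

theorem IsModerate.mul_negligible {x y : Idx → ℝ} (hx : IsModerate x) (hy : IsNegligible y) :
    IsNegligible (x * y) := by
  intro m
  obtain ⟨N, C, h⟩ := hx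
  obtain ⟨D, h'⟩ := hy (N + m)
  refine ⟨C * D, ?_⟩
  filter_upwards [h, h'] with ε h1 h2
  have hε : (ε : ℝ) ≠ 0 := ε.2.1.ne'
  rw [Pi.mul_apply, abs_mul]
  calc |x ε| * |y ε| ≤ (C * ((ε : ℝ)⁻¹) ^ N) * (D * (ε : ℝ) ^ (N + m)) :=
        mul_le_mul h1 h2 (abs_nonneg _) ((abs_nonneg _).trans h1)
    _ = C * D * (((ε : ℝ)⁻¹ * ε) ^ N * (ε : ℝ) ^ m) := by rw [mul_pow]; ring
    _ = _ := by rw [inv_mul_cancel₀ hε, one_pow, one_mul]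

/-- The ring `𝓔_M` of moderate nets of real numbers. -/
def moderateNets : Subring (Idx → ℝ) where
  carrier := {x | IsModerate x}
  mul_mem' := IsModerate.mul
  one_mem' := isModerate_const 1
  add_mem' := IsModerate.add
  zero_mem' := isModerate_const 0
  neg_mem' := IsModerate.neg

/-- The ideal `𝓝` of negligible nets in `𝓔_M`. -/
def negligibleNets : Ideal moderateNets where
  carrier := {x | IsNegligible x.1}
  add_mem' := IsNegligible.add
  zero_mem' := fun _ => ⟨0, Filter.Eventually.of_forall fun (ε : Idx) => by simp⟩
  smul_mem' := fun x _ hy => IsModerate.mul_negligible x.2 hy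

/-- The ring of generalized real numbers `𝓔_M / 𝓝`. -/
abbrev GReal : Type := moderateNets ⧸ negligibleNets

/-- The class in `GReal` of a moderate net. -/
def GReal.mk (x : Idx → ℝ) (hx : IsModerate x) : GReal :=
  Ideal.Quotient.mk negligibleNets ⟨x, hx⟩

theorem GReal.mk_eq_mk {x y : Idx → ℝ} {hx : IsModerate x} {hy : IsModerate y}
    (h : IsNegligible (x - y)) : GReal.mk x hx = GReal.mk y hy :=
  Ideal.Quotient.eq.2 h

/-- The net `x` is a representative of the generalized number `a`. -/
def Represents (x : Idx → ℝ) (a : GReal) : Prop :=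
  ∃ hx : IsModerate x, GReal.mk x hx = a

/-- `a` is strictly positive: some representative satisfies `x ε ≥ ε ^ m` for small `ε`. -/
def StrictlyPos (a : GReal) : Prop :=
  ∃ x : Idx → ℝ, Represents x a ∧ ∃ m : ℕ, ∀ᶠ ε : Idx in toZero, (ε : ℝ) ^ m ≤ x ε

/-- `a` is strictly negative. -/
def StrictlyNeg (a : GReal) : Prop := StrictlyPos (-a)

/-! ### Index of symmetric matrices and bilinear forms over `GReal` -/

/-- `θ` is the list of generalized eigenvalues of the (symmetric) matrix `A`: the classes of the
nets of eigenvalues `λ₁(ε) ≥ … ≥ λₙ(ε)`, repeated with multiplicity, of a symmetric representative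
of `A`. (`Matrix.IsHermitian.eigenvalues₀` lists them in decreasing order.) A symmetric
representative exists exactly if `A` is symmetric, and the classes do not depend on its choice. -/
def IsEigenvalueList {n : ℕ} (A : Matrix (Fin n) (Fin n) GReal) (θ : Fin n → GReal) : Prop :=
  ∃ (a : Idx → Matrix (Fin n) (Fin n) ℝ) (ha : ∀ ε, (a ε).IsHermitian),
    (∀ i k, Represents (fun ε => a ε i k) (A i k)) ∧
    ∀ k, Represents (fun ε => (ha ε).eigenvalues₀ (Fin.cast (Fintype.card_fin n).symm k)) (θ k)

/-- `ν₊(A) + ν₋(A) = n` and `ν(A) = ν₋(A) = j`, where `ν₊(A)` and `ν₋(A)` are the numbers of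
strictly positive and strictly negative eigenvalues of the symmetric matrix `A`, counted with
multiplicity. -/
def MatrixHasIndex {n : ℕ} (A : Matrix (Fin n) (Fin n) GReal) (j : ℕ) : Prop :=
  A.IsSymm ∧ ∃ θ : Fin n → GReal, IsEigenvalueList A θ ∧
    {k | StrictlyPos (θ k)}.ncard + {k | StrictlyNeg (θ k)}.ncard = n ∧
    {k | StrictlyNeg (θ k)}.ncard = j

/-- The bilinear form `b` on `GReal ^ n` is symmetric and has index `j`: its coefficient matrix
with respect to some basis has index `j`. -/
def FormHasIndex {n : ℕ} (b : LinearMap.BilinForm GReal (Fin n → GReal)) (j : ℕ) : Prop :=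
  b.IsSymm ∧ ∃ e : Module.Basis (Fin n) GReal (Fin n → GReal),
    MatrixHasIndex (Matrix.of fun i k => b (e i) (e k)) j

/-! ### Compactly supported generalized points of a subset of `ℝⁿ` -/

section Points

variable {n : ℕ}

/-- Nets of points of `Ω` which, for small `ε`, stay in one compact subset of `Ω`. -/
def PointNet (Ω : Set (EuclideanSpace ℝ (Fin n))) : Type :=
  {x : Idx → EuclideanSpace ℝ (Fin n) // (∀ ε, x ε ∈ Ω) ∧
    ∃ K ⊆ Ω, IsCompact K ∧ ∀ᶠ ε in toZero, x ε ∈ K}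

/-- Nets of points are equivalent if their distance is a negligible net. -/
def pointSetoid (Ω : Set (EuclideanSpace ℝ (Fin n))) : Setoid (PointNet Ω) where
  r x y := IsNegligible fun ε => dist (x.1 ε) (y.1 ε)
  iseqv :=
    { refl := fun x m => ⟨0, Filter.Eventually.of_forall fun ε => by simp⟩
      symm := fun {x y} h => by simpa only [dist_comm] using h
      trans := fun {x y z} h h' m => by
        obtain ⟨C, hC⟩ := (h.add h') m
        refine ⟨C, hC.mono fun ε hε => le_trans ?_ hε⟩
        rw [Pi.add_apply, abs_of_nonneg dist_nonneg, abs_of_nonneg (add_nonneg dist_nonneg dist_nonneg)]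
        exact dist_triangle _ _ _ }

/-- The compactly supported generalized points of `Ω`. -/
def GenPoint (Ω : Set (EuclideanSpace ℝ (Fin n))) : Type := Quotient (pointSetoid Ω)

/-- A net of functions is moderate on `Ω`: derivatives of each order are `O(ε ^ (-N))` for some
`N`, uniformly on each compact subset of `Ω`. -/
def IsModerateOn (Ω : Set (EuclideanSpace ℝ (Fin n)))
    (u : Idx → EuclideanSpace ℝ (Fin n) → ℝ) : Prop :=
  ∀ K ⊆ Ω, IsCompact K → ∀ k : ℕ, ∃ (N : ℕ) (C : ℝ), ∀ᶠ ε in toZero, ∀ y ∈ K,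
    ‖iteratedFDeriv ℝ k (u ε) y‖ ≤ C * ((ε : ℝ)⁻¹) ^ N

/-- A net of functions is negligible on `Ω`: derivatives of each order are `O(ε ^ m)` for each
`m`, uniformly on each compact subset of `Ω`. -/
def IsNegligibleOn (Ω : Set (EuclideanSpace ℝ (Fin n)))
    (u : Idx → EuclideanSpace ℝ (Fin n) → ℝ) : Prop :=
  ∀ K ⊆ Ω, IsCompact K → ∀ k m : ℕ, ∃ C : ℝ, ∀ᶠ ε in toZero, ∀ y ∈ K,
    ‖iteratedFDeriv ℝ k (u ε) y‖ ≤ C * (ε : ℝ) ^ m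

variable {Ω : Set (EuclideanSpace ℝ (Fin n))} {u v : Idx → EuclideanSpace ℝ (Fin n) → ℝ}

theorem IsModerateOn.add (hΩ : IsOpen Ω) (su : ∀ ε, ContDiffOn ℝ ∞ (u ε) Ω)
    (sv : ∀ ε, ContDiffOn ℝ ∞ (v ε) Ω) (hu : IsModerateOn Ω u) (hv : IsModerateOn Ω v) :
    IsModerateOn Ω (fun ε => u ε + v ε) := by
  intro K hK hKc k
  obtain ⟨N, C, h⟩ := hu K hK hKc k
  obtain ⟨M, D, h'⟩ := hv K hK hKc k
  refine ⟨N + M, |C| + |D|, ?_⟩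
  filter_upwards [h, h'] with ε h1 h2 y hy
  have hy' := hΩ.mem_nhds (hK hy)
  rw [iteratedFDeriv_add_apply (((su ε).contDiffAt hy').of_le (mod_cast le_top))
    (((sv ε).contDiffAt hy').of_le (mod_cast le_top))]
  exact (norm_add_le _ _).trans (bound_add ε N M (h1 y hy) (h2 y hy))

theorem IsNegligibleOn.add (hΩ : IsOpen Ω) (su : ∀ ε, ContDiffOn ℝ ∞ (u ε) Ω)
    (sv : ∀ ε, ContDiffOn ℝ ∞ (v ε) Ω) (hu : IsNegligibleOn Ω u) (hv : IsNegligibleOn Ω v) :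
    IsNegligibleOn Ω (fun ε => u ε + v ε) := by
  intro K hK hKc k m
  obtain ⟨C, h⟩ := hu K hK hKc k m
  obtain ⟨D, h'⟩ := hv K hK hKc k m
  refine ⟨C + D, ?_⟩
  filter_upwards [h, h'] with ε h1 h2 y hy
  have hy' := hΩ.mem_nhds (hK hy)
  rw [iteratedFDeriv_add_apply (((su ε).contDiffAt hy').of_le (mod_cast le_top))
    (((sv ε).contDiffAt hy').of_le (mod_cast le_top)), add_mul]
  exact (norm_add_le _ _).trans (add_le_add (h1 y hy) (h2 y hy))

theorem IsModerateOn.neg (hu : IsModerateOn Ω u) : IsModerateOn Ω (fun ε => -u ε) := by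
  intro K hK hKc k
  obtain ⟨N, C, h⟩ := hu K hK hKc k
  exact ⟨N, C, by simpa [iteratedFDeriv_neg_apply] using h⟩

theorem IsNegligibleOn.neg (hu : IsNegligibleOn Ω u) : IsNegligibleOn Ω (fun ε => -u ε) := by
  intro K hK hKc k m
  obtain ⟨C, h⟩ := hu K hK hKc k m
  exact ⟨C, by simpa [iteratedFDeriv_neg_apply] using h⟩

theorem IsModerateOn.comp_point (hu : IsModerateOn Ω u) (x : PointNet Ω) :
    IsModerate fun ε => u ε (x.1 ε) := by
  obtain ⟨K, hK, hKc, hx⟩ := x.2.2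
  obtain ⟨N, C, h⟩ := hu K hK hKc 0
  refine ⟨N, C, ?_⟩
  filter_upwards [hx, h] with ε h1 h2
  simpa using h2 _ h1

theorem IsNegligibleOn.comp_point (hu : IsNegligibleOn Ω u) (x : PointNet Ω) :
    IsNegligible fun ε => u ε (x.1 ε) := by
  intro m
  obtain ⟨K, hK, hKc, hx⟩ := x.2.2
  obtain ⟨C, h⟩ := hu K hK hKc 0 m
  refine ⟨C, ?_⟩
  filter_upwards [hx, h] with ε h1 h2
  simpa using h2 _ h1

/-- Values of a moderate net at equivalent nets of points differ by a negligible net. -/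
theorem IsModerateOn.negligible_sub (hΩ : IsOpen Ω) (su : ∀ ε, ContDiffOn ℝ ∞ (u ε) Ω)
    (hu : IsModerateOn Ω u) (x y : PointNet Ω)
    (hxy : IsNegligible fun ε => dist (x.1 ε) (y.1 ε)) :
    IsNegligible fun ε => u ε (x.1 ε) - u ε (y.1 ε) := by
  intro m
  obtain ⟨K, hK, hKc, hx⟩ := x.2.2
  obtain ⟨δ, hδ, hsub⟩ := hKc.exists_cthickening_subset_open hΩ hK
  obtain ⟨N, C, h⟩ := hu _ hsub hKc.cthickening 1
  obtain ⟨D, hD⟩ := hxy (N + m)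
  obtain ⟨D', hD'⟩ := hxy 1
  have hlim : Filter.Tendsto (fun ε : Idx => D' * (ε : ℝ) ^ 1) toZero (𝓝 (D' * 0 ^ 1)) :=
    ((Filter.tendsto_comap (x := 𝓝 (0 : ℝ)) (f := (Subtype.val : Idx → ℝ))).pow 1).const_mul D'
  have hsmall : ∀ᶠ ε : Idx in toZero, D' * (ε : ℝ) ^ 1 < δ :=
    hlim.eventually_lt_const (by simpa using hδ)
  refine ⟨C * D, ?_⟩
  filter_upwards [hx, h, hD, hD', hsmall] with ε hxK hder hd hd' hs
  rw [abs_of_nonneg dist_nonneg] at hd hd'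
  have hball : Metric.closedBall (x.1 ε) δ ⊆ Metric.cthickening δ K :=
    Metric.closedBall_subset_cthickening hxK δ
  have hmv := (convex_closedBall (x.1 ε) δ).norm_image_sub_le_of_norm_fderiv_le
    (𝕜 := ℝ) (f := u ε) (C := C * ((ε : ℝ)⁻¹) ^ N) (x := y.1 ε) (y := x.1 ε)
    (fun z hz => ((su ε).contDiffAt (hΩ.mem_nhds (hsub (hball hz)))).differentiableAt (by simp))
    (fun z hz => by simpa [norm_iteratedFDeriv_one] using hder z (hball hz))
    (by rw [Metric.mem_closedBall, dist_comm]; exact hd'.trans hs.le)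
    (Metric.mem_closedBall_self hδ.le)
  have hC : 0 ≤ C * ((ε : ℝ)⁻¹) ^ N :=
    (norm_nonneg _).trans (hder _ (hball (Metric.mem_closedBall_self hδ.le)))
  have hε : (ε : ℝ) ≠ 0 := ε.2.1.ne'
  rw [← dist_eq_norm] at hmv
  calc |u ε (x.1 ε) - u ε (y.1 ε)| ≤ C * ((ε : ℝ)⁻¹) ^ N * dist (x.1 ε) (y.1 ε) := by
        rw [← Real.dist_eq, dist_eq_norm (x.1 ε)]; rw [dist_eq_norm] at hmv ⊢; exact hmv
    _ ≤ C * ((ε : ℝ)⁻¹) ^ N * (D * (ε : ℝ) ^ (N + m)) := mul_le_mul_of_nonneg_left hd hC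
    _ = C * D * (((ε : ℝ)⁻¹ * ε) ^ N * (ε : ℝ) ^ m) := by rw [mul_pow]; ring
    _ = _ := by rw [inv_mul_cancel₀ hε, one_pow, one_mul]

end Points

/-! ### Generalized tensors of type `(0, 2)` on a manifold -/

section Tensors

variable (n : ℕ) (X : Type*) [TopologicalSpace X] [ChartedSpace (EuclideanSpace ℝ (Fin n)) X]
  [IsManifold (𝓡 n) ∞ X]

/-- Smooth tensor fields of type `(0, 2)` on `X`. -/
abbrev SmoothTensor : Type _ :=
  ContMDiffSection (𝓡 n)
    (EuclideanSpace ℝ (Fin n) →L[ℝ] EuclideanSpace ℝ (Fin n) →L[ℝ] ℝ) ∞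
    (fun p : X => TangentSpace (𝓡 n) p →L[ℝ] TangentSpace (𝓡 n) p →L[ℝ] ℝ)

instance instContinuousAddCotangent (p : X) :
    ContinuousAdd (TangentSpace (𝓡 n) p →L[ℝ] ℝ) := inferInstance

instance instIsTopologicalAddGroupCotangent (p : X) :
    IsTopologicalAddGroup (TangentSpace (𝓡 n) p →L[ℝ] ℝ) := inferInstance

variable {n X}

/-- The component `g(∂ᵢ, ∂ₖ)` of `s` in the chart `φ`, as a function of the coordinates (of
interest on `φ.target` only); `∂ᵢ` is the image of the `i`-th standard basis vector under the
derivative of `φ⁻¹`. -/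
def component (s : SmoothTensor n X) (φ : OpenPartialHomeomorph X (EuclideanSpace ℝ (Fin n)))
    (i k : Fin n) (y : EuclideanSpace ℝ (Fin n)) : ℝ :=
  s (φ.symm y) (mfderiv (𝓡 n) (𝓡 n) φ.symm y (EuclideanSpace.single i (1 : ℝ)))
    (mfderiv (𝓡 n) (𝓡 n) φ.symm y (EuclideanSpace.single k (1 : ℝ)))

theorem component_add (s t : SmoothTensor n X)
    (φ : OpenPartialHomeomorph X (EuclideanSpace ℝ (Fin n))) (i k : Fin n) :
    component (s + t) φ i k = component s φ i k + component t φ i k := rfl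

theorem component_neg (s : SmoothTensor n X)
    (φ : OpenPartialHomeomorph X (EuclideanSpace ℝ (Fin n))) (i k : Fin n) :
    component (-s) φ i k = -component s φ i k := rfl

theorem component_zero (φ : OpenPartialHomeomorph X (EuclideanSpace ℝ (Fin n))) (i k : Fin n) :
    component (0 : SmoothTensor n X) φ i k = 0 := rfl

theorem contMDiffOn_frame {φ : OpenPartialHomeomorph X (EuclideanSpace ℝ (Fin n))}
    (hφ : φ ∈ IsManifold.maximalAtlas (𝓡 n) ∞ X) (v : EuclideanSpace ℝ (Fin n)) :
    ContMDiffOn (𝓡 n) (𝓡 n).tangent ∞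
      (fun y => Bundle.TotalSpace.mk' (EuclideanSpace ℝ (Fin n))
        (E := (TangentSpace (𝓡 n) : X → Type _)) (φ.symm y)
        (mfderiv (𝓡 n) (𝓡 n) φ.symm y v)) φ.target := by
  have h1 := (contMDiffOn_symm_of_mem_maximalAtlas hφ).contMDiffOn_tangentMapWithin
    (m := ∞) (by simp) φ.open_target.uniqueMDiffOn
  have h2 : ContMDiff (𝓡 n) (𝓡 n).tangent ∞
      (fun y => (⟨y, v⟩ : TangentBundle (𝓡 n) (EuclideanSpace ℝ (Fin n)))) :=
    contMDiff_vectorSpace_iff_contDiff.2 contDiff_const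
  refine (h1.comp h2.contMDiffOn (s := φ.target) fun y hy => hy).congr fun y hy => ?_
  simp only [Function.comp, tangentMapWithin]
  rw [mfderivWithin_of_isOpen φ.open_target hy]

/-- The components of a smooth tensor field are smooth. -/
theorem contDiffOn_component (s : SmoothTensor n X)
    {φ : OpenPartialHomeomorph X (EuclideanSpace ℝ (Fin n))}
    (hφ : φ ∈ IsManifold.maximalAtlas (𝓡 n) ∞ X) (i k : Fin n) :
    ContDiffOn ℝ ∞ (component s φ i k) φ.target := by
  rw [← contMDiffOn_iff_contDiffOn]
  have hb := contMDiffOn_symm_of_mem_maximalAtlas hφ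
  have h : ContMDiffOn (𝓡 n) ((𝓡 n).prod 𝓘(ℝ)) ∞
      (fun y => Bundle.TotalSpace.mk' ℝ (E := Bundle.Trivial X ℝ) (φ.symm y)
        (component s φ i k y)) φ.target := by
    apply ContMDiffOn.clm_bundle_apply₂ (F₁ := EuclideanSpace ℝ (Fin n))
      (F₂ := EuclideanSpace ℝ (Fin n))
    · exact s.contMDiff.comp_contMDiffOn hb
    · exact contMDiffOn_frame hφ _
    · exact contMDiffOn_frame hφ _
  intro y hy
  have := h y hy
  simp only [Bundle.contMDiffWithinAt_totalSpace] at this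
  exact this.2

variable (n X)

/-- The moderate nets of smooth tensor fields: in each chart the components are moderate. -/
def moderateTensors : AddSubgroup (Idx → SmoothTensor n X) where
  carrier := {s | ∀ φ ∈ IsManifold.maximalAtlas (𝓡 n) ∞ X, ∀ i k : Fin n,
    IsModerateOn φ.target fun ε => component (s ε) φ i k}
  add_mem' := fun {s t} hs ht φ hφ i k =>
    (hs φ hφ i k).add φ.open_target (fun ε => contDiffOn_component (s ε) hφ i k)
      (fun ε => contDiffOn_component (t ε) hφ i k) (ht φ hφ i k)
  zero_mem' := fun φ _ i k K _ _ l => ⟨0, 0, Filter.Eventually.of_forall fun ε y _ => by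
    simp only [Pi.zero_apply, component_zero]
    simp⟩
  neg_mem' := fun {s} hs φ hφ i k => (hs φ hφ i k).neg

/-- The negligible nets of smooth tensor fields: in each chart the components are negligible. -/
def negligibleTensors : AddSubgroup (moderateTensors n X) where
  carrier := {s | ∀ φ ∈ IsManifold.maximalAtlas (𝓡 n) ∞ X, ∀ i k : Fin n,
    IsNegligibleOn φ.target fun ε => component (s.1 ε) φ i k}
  add_mem' := fun {s t} hs ht φ hφ i k =>
    (hs φ hφ i k).add φ.open_target (fun ε => contDiffOn_component (s.1 ε) hφ i k)
      (fun ε => contDiffOn_component (t.1 ε) hφ i k) (ht φ hφ i k)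
  zero_mem' := fun φ _ i k K _ _ l m => ⟨0, Filter.Eventually.of_forall fun ε y _ => by
    simp only [ZeroMemClass.coe_zero, Pi.zero_apply, component_zero]
    simp⟩
  neg_mem' := fun {s} hs φ hφ i k => (hs φ hφ i k).neg

/-- The generalized tensors of type `(0, 2)` on `X`. -/
abbrev GenTensor : Type _ := moderateTensors n X ⧸ negligibleTensors n X

variable {n X}

/-- The net `s` is a representative of the generalized tensor `g`. -/
def TensorRepresents (s : Idx → SmoothTensor n X) (g : GenTensor n X) : Prop :=
  ∃ hs : s ∈ moderateTensors n X, (QuotientAddGroup.mk ⟨s, hs⟩ : GenTensor n X) = g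

/-- The value in `GReal` of the component `g_{ik}` of `g` in the chart `φ` at the generalized point
`x` of `φ.target`: the class of the net `g^ε_{ik}(x_ε)`. -/
def componentAt (g : GenTensor n X) (φ : OpenPartialHomeomorph X (EuclideanSpace ℝ (Fin n)))
    (hφ : φ ∈ IsManifold.maximalAtlas (𝓡 n) ∞ X) (x : GenPoint φ.target) (i k : Fin n) : GReal :=
  Quotient.liftOn₂ g x
    (fun s y => GReal.mk (fun ε => component (s.1 ε) φ i k (y.1 ε))
      ((s.2 φ hφ i k).comp_point y))
    (by
      intro s y t z hst hyz
      have hst' : -s + t ∈ negligibleTensors n X := QuotientAddGroup.leftRel_apply.1 hst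
      have h1 := ((hst' φ hφ i k).neg).comp_point y
      have h2 := (t.2 φ hφ i k).negligible_sub φ.open_target
        (fun ε => contDiffOn_component (t.1 ε) hφ i k) y z hyz
      refine GReal.mk_eq_mk ?_
      convert h1.add h2 using 1
      funext ε
      have h3 : component ((-s + t).1 ε) φ i k (y.1 ε) =
        -component (s.1 ε) φ i k (y.1 ε) + component (t.1 ε) φ i k (y.1 ε) := rfl
      simp only [Pi.sub_apply, Pi.add_apply, Pi.neg_apply]
      rw [h3]
      ring)

/-- The bilinear form `g_φ(x)` on `GReal ^ n` with coefficients `g_{ik}(x)`. -/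
def evalForm (g : GenTensor n X) (φ : OpenPartialHomeomorph X (EuclideanSpace ℝ (Fin n)))
    (hφ : φ ∈ IsManifold.maximalAtlas (𝓡 n) ∞ X) (x : GenPoint φ.target) :
    LinearMap.BilinForm GReal (Fin n → GReal) :=
  Matrix.toBilin' (Matrix.of fun i k => componentAt g φ hφ x i k)

/-- `g` is symmetric and non-degenerate: so is `g_φ(x)` for each chart `φ` and each compactly
supported generalized point `x` of its range. -/
def IsSymmNondegenerate (g : GenTensor n X) : Prop :=
  ∀ (φ : OpenPartialHomeomorph X (EuclideanSpace ℝ (Fin n)))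
    (hφ : φ ∈ IsManifold.maximalAtlas (𝓡 n) ∞ X) (x : GenPoint φ.target),
    (evalForm g φ hφ x).IsSymm ∧ (evalForm g φ hφ x).Nondegenerate

/-- The bilinear form of a smooth tensor field on the tangent space at `p`. -/
def formAt (s : SmoothTensor n X) (p : X) : LinearMap.BilinForm ℝ (TangentSpace (𝓡 n) p) :=
  (s p).toLinearMap₁₂

/-- On `V`, the smooth tensor field `s` is a pseudo-Riemannian metric of index `j`; the index is
the maximal dimension of a subspace of the tangent space on which the form is negative definite. -/
def IsPseudoRiemannianOn (s : SmoothTensor n X) (V : Set X) (j : ℕ) : Prop :=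
  ∀ p ∈ V, (formAt s p).IsSymm ∧ (formAt s p).Nondegenerate ∧
    sigNeg (LinearMap.BilinMap.toQuadraticMap (formAt s p)) = j

/-- The generalized tensor `g` has (constant) index `j`. -/
def TensorHasIndex (g : GenTensor n X) (j : ℕ) : Prop :=
  ∀ V : Set X, IsOpen V → IsCompact (closure V) →
    ∃ s : Idx → SmoothTensor n X, TensorRepresents s g ∧
      ∃ ε₀ > (0 : ℝ), ∀ ε : Idx, (ε : ℝ) < ε₀ → IsPseudoRiemannianOn (s ε) V j

end Tensors

end Colombeau

end

noncomputable section

namespace Colombeau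

/-! ### The filter `ε → 0` and generalized numbers -/

/-! Everything rests on one stability principle: eigenvalues bounded away from zero by a power of
`ε` keep their signs under negligible perturbations. Its real form is a quantitative law of inertia,
`sigNeg_eq_ncard_eigenvalue_neg`: if a quadratic form, pulled back by a linear map from `ℝⁿ`, has a
matrix closer to a symmetric `a` than the spectral gap of `a` at zero, then positive and negative
definite subspaces of total dimension `n` appear, so the form is nondegenerate with the index of
`a`. The linear map need not be known to be invertible, so neither coordinate frames nor generalized
bases have to be inverted.

For 1 ⇒ 2, nondegeneracy over `GReal` supplies the gap (`exists_pow_le_abs_eigenvalue`): otherwise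
unit eigenvectors along a sequence `ε → 0`, extended by zero, form a nonzero generalized vector in
the kernel. A representative that is a metric of index `j` near the relevant compact set then has
exactly `j` negative eigenvalues at `x_ε`. Since they are ordered, the same positions are negative
for all small `ε`, and the generalized eigenvalues have definite signs.

For 2 ⇒ 1, take the symmetric part of any representative. It still represents `g`, because its
difference from the original has negligible point values, which by an interpolation inequality makes
all derivatives negligible too. If it failed to be a metric of index `j` on a compact set in a chart
for arbitrarily small `ε`, points of failure would form a generalized point, where the index
hypothesis and stability give a contradiction. Finitely many such compact sets cover the closure of
`V`. -/

theorem eventually_toZero_iff {P : Idx → Prop} :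
    (∀ᶠ ε in toZero, P ε) ↔ ∃ δ > (0 : ℝ), ∀ ε : Idx, (ε : ℝ) < δ → P ε := by
  rw [toZero, (Metric.nhds_basis_ball.comap _).eventually_iff]
  refine exists_congr fun δ => and_congr_right fun _ => forall_congr' fun ε => ?_
  simp [abs_of_pos ε.2.1]

instance toZero_neBot : toZero.NeBot := by
  rw [← Filter.frequently_true_iff_neBot, Filter.Frequently, eventually_toZero_iff]
  rintro ⟨δ, hδ, h⟩
  exact h ⟨min (δ / 2) 1, lt_min (half_pos hδ) one_pos, min_le_right _ _⟩
    ((min_le_left _ _).trans_lt (half_lt_self hδ)) trivial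

theorem eventually_lt_toZero {δ : ℝ} (hδ : 0 < δ) : ∀ᶠ ε : Idx in toZero, (ε : ℝ) < δ :=
  eventually_toZero_iff.2 ⟨δ, hδ, fun _ h => h⟩

/-- Constants are absorbed by one power of `ε`. -/
theorem eventually_const_mul_pow_lt (C : ℝ) {c : ℝ} (hc : 0 < c) (m : ℕ) :
    ∀ᶠ ε : Idx in toZero, C * (ε : ℝ) ^ (m + 1) < c * (ε : ℝ) ^ m := by
  filter_upwards [eventually_lt_toZero (δ := c / (|C| + 1)) (by positivity)] with ε hε
  have hp := pow_pos ε.2.1 m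
  rw [lt_div_iff₀ (by positivity)] at hε
  rw [pow_succ, mul_comm ((ε : ℝ) ^ m), ← mul_assoc]
  refine mul_lt_mul_of_pos_right ?_ hp
  nlinarith [le_abs_self C, ε.2.1]

theorem IsNegligible.eventually_lt {x : Idx → ℝ} (hx : IsNegligible x) {c : ℝ} (hc : 0 < c)
    (m : ℕ) : ∀ᶠ ε : Idx in toZero, |x ε| < c * (ε : ℝ) ^ m := by
  obtain ⟨C, hC⟩ := hx (m + 1)
  filter_upwards [hC, eventually_const_mul_pow_lt C hc m] with ε h1 h2 using h1.trans_lt h2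

theorem IsNegligible.of_abs_le {x y : Idx → ℝ} (hy : IsNegligible y)
    (h : ∀ᶠ ε in toZero, |x ε| ≤ |y ε|) : IsNegligible x := fun m => by
  obtain ⟨C, hC⟩ := hy m
  exact ⟨C, by filter_upwards [hC, h] with ε h1 h2 using h2.trans h1⟩

theorem IsModerate.of_abs_le {x y : Idx → ℝ} (hy : IsModerate y)
    (h : ∀ᶠ ε in toZero, |x ε| ≤ |y ε|) : IsModerate x := by
  obtain ⟨N, C, hC⟩ := hy
  exact ⟨N, C, by filter_upwards [hC, h] with ε h1 h2 using h2.trans h1⟩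

theorem IsModerate.sum {ι : Type*} (s : Finset ι) {x : ι → Idx → ℝ}
    (hx : ∀ i ∈ s, IsModerate (x i)) : IsModerate (∑ i ∈ s, x i) :=
  moderateNets.sum_mem hx

theorem IsModerate.abs {x : Idx → ℝ} (hx : IsModerate x) : IsModerate fun ε => |x ε| :=
  hx.of_abs_le (Filter.Eventually.of_forall fun _ => (abs_abs _).le)

namespace Represents

variable {x y : Idx → ℝ} {a b : GReal}

theorem exists_of (a : GReal) : ∃ x, Represents x a := by
  obtain ⟨x, rfl⟩ := Ideal.Quotient.mk_surjective a
  exact ⟨x.1, x.2, rfl⟩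

theorem negligible_sub (hx : Represents x a) (hy : Represents y a) : IsNegligible (x - y) := by
  obtain ⟨hx, rfl⟩ := hx
  obtain ⟨hy, h⟩ := hy
  exact Ideal.Quotient.eq.1 h.symm

theorem of_negligible_sub (hx : Represents x a) (hy : IsModerate y) (h : IsNegligible (x - y)) :
    Represents y a := by
  obtain ⟨hx, rfl⟩ := hx
  exact ⟨hy, (GReal.mk_eq_mk h).symm⟩

theorem eq_zero_iff (hx : Represents x a) : a = 0 ↔ IsNegligible x := by
  obtain ⟨hx, rfl⟩ := hx
  exact Ideal.Quotient.eq_zero_iff_mem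

theorem add (hx : Represents x a) (hy : Represents y b) : Represents (x + y) (a + b) := by
  obtain ⟨hx, rfl⟩ := hx
  obtain ⟨hy, rfl⟩ := hy
  exact ⟨hx.add hy, rfl⟩

theorem mul (hx : Represents x a) (hy : Represents y b) : Represents (x * y) (a * b) := by
  obtain ⟨hx, rfl⟩ := hx
  obtain ⟨hy, rfl⟩ := hy
  exact ⟨hx.mul hy, rfl⟩

theorem neg (hx : Represents x a) : Represents (-x) (-a) := by
  obtain ⟨hx, rfl⟩ := hx
  exact ⟨hx.neg, rfl⟩

theorem zero : Represents 0 0 := ⟨isModerate_const 0, rfl⟩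

theorem sum {ι : Type*} (s : Finset ι) {x : ι → Idx → ℝ} {a : ι → GReal}
    (h : ∀ i ∈ s, Represents (x i) (a i)) : Represents (∑ i ∈ s, x i) (∑ i ∈ s, a i) := by
  classical
  induction s using Finset.induction_on with
  | empty => simpa using zero
  | insert i s hi ih =>
    rw [Finset.sum_insert hi, Finset.sum_insert hi]
    exact (h i (Finset.mem_insert_self i s)).add
      (ih fun k hk => h k (Finset.mem_insert_of_mem hk))

theorem strictlyPos (hx : Represents x a) (m : ℕ) (h : ∀ᶠ ε : Idx in toZero, (ε : ℝ) ^ m ≤ x ε) :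
    StrictlyPos a := ⟨x, hx, m, h⟩

theorem strictlyNeg (hx : Represents x a) (m : ℕ) (h : ∀ᶠ ε : Idx in toZero, x ε ≤ -(ε : ℝ) ^ m) :
    StrictlyNeg a :=
  ⟨-x, hx.neg, m, h.mono fun ε hε => by rw [Pi.neg_apply]; linarith⟩

/-- Passing to another representative costs one power of `ε`: the negligible difference is below `ε
^ m / 2`, and so is `ε ^ (m + 1)`. -/
theorem exists_pow_le_of_strictlyPos (hx : Represents x a) (ha : StrictlyPos a) :
    ∃ m : ℕ, ∀ᶠ ε : Idx in toZero, (ε : ℝ) ^ m ≤ x ε := by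
  obtain ⟨y, hy, m, h⟩ := ha
  refine ⟨m + 1, ?_⟩
  filter_upwards [h, (hx.negligible_sub hy).eventually_lt (c := 1 / 2) (by norm_num) m,
    eventually_const_mul_pow_lt 1 (c := 1 / 2) (by norm_num) m] with ε h1 h2 h3
  have := (abs_lt.1 h2).1
  rw [Pi.sub_apply] at this
  linarith

theorem exists_le_neg_pow_of_strictlyNeg (hx : Represents x a) (ha : StrictlyNeg a) :
    ∃ m : ℕ, ∀ᶠ ε : Idx in toZero, x ε ≤ -(ε : ℝ) ^ m := by
  obtain ⟨m, h⟩ := hx.neg.exists_pow_le_of_strictlyPos ha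
  exact ⟨m, h.mono fun ε hε => by rw [Pi.neg_apply] at hε; linarith⟩

end Represents

theorem StrictlyPos.not_strictlyNeg {a : GReal} (h : StrictlyPos a) : ¬StrictlyNeg a := by
  intro h'
  obtain ⟨x, hx⟩ := Represents.exists_of a
  obtain ⟨m, hm⟩ := hx.exists_pow_le_of_strictlyPos h
  obtain ⟨k, hk⟩ := hx.exists_le_neg_pow_of_strictlyNeg h'
  obtain ⟨ε, h1, h2⟩ := (hm.and hk).exists
  linarith [pow_pos ε.2.1 m, pow_pos ε.2.1 k]

/-- If for each `m` the `m`-th of a decreasing sequence of properties holds for arbitrarily small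
`ε`, then there is a set of indices accumulating at `0` on which all of them hold eventually. -/
theorem exists_frequently_mem_of_antitone {P : ℕ → Idx → Prop}
    (hP : ∀ m k ε, m ≤ k → P k ε → P m ε) (h : ∀ m, ∃ᶠ ε in toZero, P m ε) :
    ∃ S : Set Idx, (∃ᶠ ε in toZero, ε ∈ S) ∧ ∀ m, ∀ᶠ ε in toZero, ε ∈ S → P m ε := by
  have h' : ∀ m : ℕ, ∃ ε : Idx, P m ε ∧ (ε : ℝ) < 1 / ((m : ℝ) + 1) := fun m =>
    ((h m).and_eventually (eventually_lt_toZero (by positivity))).exists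
  choose e he hlt using h'
  refine ⟨Set.range e, ?_, fun m => ?_⟩
  · intro hcon
    obtain ⟨δ, hδ, hcon⟩ := eventually_toZero_iff.1 hcon
    obtain ⟨m, hm⟩ := exists_nat_one_div_lt hδ
    exact hcon (e m) ((hlt m).trans hm) ⟨m, rfl⟩
  -- Once `ε` is smaller than `e 0, …, e (m - 1)`, it can equal `e k` only for some `k ≥ m`.
  · have hsmall : ∀ᶠ ε : Idx in toZero, ∀ k ∈ Finset.range m, (ε : ℝ) < e k :=
      (Filter.eventually_all_finset _).2 fun k _ => eventually_lt_toZero (e k).2.1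
    filter_upwards [hsmall] with ε hε hS
    obtain ⟨k, rfl⟩ := hS
    refine hP m k _ ?_ (he k)
    by_contra hk
    exact lt_irrefl _ (hε k (Finset.mem_range.2 (not_le.1 hk)))

/-! ### Signature of real quadratic forms -/

section Signature

variable {n : ℕ} {V : Type*} [AddCommGroup V] [Module ℝ V]

theorem finrank_map_eq_of_ne_zero {U : Submodule ℝ (Fin n → ℝ)} (T : (Fin n → ℝ) →ₗ[ℝ] V)
    (h : ∀ c ∈ U, c ≠ 0 → T c ≠ 0) : Module.finrank ℝ (U.map T) = Module.finrank ℝ U := by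
  rw [← LinearMap.range_domRestrict]
  refine LinearMap.finrank_range_of_inj ((injective_iff_map_eq_zero _).2 fun c hc => ?_)
  by_contra h0
  exact h c.1 c.2 (fun h1 => h0 (Subtype.ext h1)) hc

/-- On vectors supported where `l` is positive, the diagonal form exceeds the error `η * ∑ c i ^ 2`,
so `Q ∘ T` is positive definite there. This also makes `T` injective on that coordinate subspace,
since `Q 0 = 0`; its image therefore has the right dimension. -/
theorem ncard_pos_le_sigPos [FiniteDimensional ℝ V] (Q : QuadraticForm ℝ V)
    (T : (Fin n → ℝ) →ₗ[ℝ] V) (l : Fin n → ℝ) (η : ℝ) (hl : ∀ i, η < |l i|)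
    (h : ∀ c, |Q (T c) - ∑ i, l i * c i ^ 2| ≤ η * ∑ i, c i ^ 2) :
    {i | 0 < l i}.ncard ≤ sigPos Q := by
  have key : ∀ c ∈ Pi.spanSubset ℝ {i | 0 < l i}, c ≠ 0 → 0 < Q (T c) := by
    intro c hc hc0
    rw [Pi.mem_spanSubset_iff] at hc
    obtain ⟨i, hi⟩ := Function.ne_iff.1 hc0
    have h1 := (abs_le.1 (h c)).1
    have h2 : η * ∑ i, c i ^ 2 < ∑ i, l i * c i ^ 2 := by
      rw [Finset.mul_sum]
      have h3 : ∀ k, k ∉ {i | 0 < l i} ∨ η < l k := fun k => by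
        by_cases hk : 0 < l k
        · exact Or.inr (by simpa [abs_of_pos hk] using hl k)
        · exact Or.inl hk
      refine Finset.sum_lt_sum (fun k _ => ?_) ⟨i, Finset.mem_univ i, ?_⟩
      · rcases h3 k with hk | hk
        · simp [hc k hk]
        · exact mul_le_mul_of_nonneg_right hk.le (sq_nonneg _)
      · rcases h3 i with hk | hk
        · exact absurd (hc i hk) hi
        · exact mul_lt_mul_of_pos_right hk (sq_pos_of_ne_zero hi)
    linarith
  rw [← Pi.dim_spanSubset (R := ℝ), ← finrank_map_eq_of_ne_zero T fun c hc hc0 hT => by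
    have := key c hc hc0
    rw [hT, QuadraticMap.map_zero] at this
    exact lt_irrefl _ this]
  refine le_sigPos_of_posDef Q ?_
  rintro ⟨_, c, hc, rfl⟩ hx
  exact key c hc fun h0 => hx (by simp [h0])

theorem ncard_neg_le_sigNeg [FiniteDimensional ℝ V] (Q : QuadraticForm ℝ V)
    (T : (Fin n → ℝ) →ₗ[ℝ] V) (l : Fin n → ℝ) (η : ℝ) (hl : ∀ i, η < |l i|)
    (h : ∀ c, |Q (T c) - ∑ i, l i * c i ^ 2| ≤ η * ∑ i, c i ^ 2) :
    {i | l i < 0}.ncard ≤ sigNeg Q := by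
  have := ncard_pos_le_sigPos (-Q) T (-l) η (by simpa using hl) fun c => by
    rw [← abs_neg]
    convert h c using 2
    simp only [neg_apply, Pi.neg_apply, neg_mul, Finset.sum_neg_distrib]
    ring
  simpa using this

/-- A quadratic form which, after a linear substitution, is close to a diagonal form with entries
bounded away from zero is nondegenerate and has as many negative squares as the diagonal form. -/
theorem sigNeg_eq_and_radical_eq_bot [FiniteDimensional ℝ V] (hV : Module.finrank ℝ V = n)
    (Q : QuadraticForm ℝ V)
    (T : (Fin n → ℝ) →ₗ[ℝ] V) (l : Fin n → ℝ) (η : ℝ) (hη : 0 ≤ η) (hl : ∀ i, η < |l i|)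
    (h : ∀ c, |Q (T c) - ∑ i, l i * c i ^ 2| ≤ η * ∑ i, c i ^ 2) :
    sigNeg Q = {i | l i < 0}.ncard ∧ Q.radical = ⊥ := by
  have h1 := ncard_pos_le_sigPos Q T l η hl h
  have h2 := ncard_neg_le_sigNeg Q T l η hl h
  have h3 := QuadraticForm.sigPos_add_sigNeg_add_radical (Q := Q)
  have h4 : {i | 0 < l i}.ncard + {i | l i < 0}.ncard = n := by
    have : {i | l i < 0} = {i | 0 < l i}ᶜ := by
      ext i
      have := abs_pos.1 (hη.trans_lt (hl i))
      simp only [Set.mem_ofPred_eq, Set.mem_compl_iff, not_lt]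
      exact ⟨le_of_lt, fun h => lt_of_le_of_ne h this⟩
    rw [this, Set.ncard_add_ncard_compl, Nat.card_fin]
  -- The two lower bounds already add up to `n`, which is the sum of both signature counts and the
  -- dimension of the radical; so both bounds are sharp and the radical vanishes.
  exact ⟨by omega, Submodule.finrank_eq_zero.1 (by omega)⟩

theorem nondegenerate_of_radical_eq_bot {b : LinearMap.BilinForm ℝ V} (hb : b.IsSymm)
    (h : (LinearMap.BilinMap.toQuadraticMap b).radical = ⊥) : b.Nondegenerate := by
  have key : ∀ x, (∀ y, b x y = 0) → x = 0 := fun x hx => by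
    rw [← Submodule.mem_bot ℝ, ← h, QuadraticMap.mem_radical_iff']
    refine ⟨hx x, fun y => ?_⟩
    have : b y x = 0 := (hb.eq x y).symm.trans (hx y)
    simp [hx, this]
  refine ⟨key, fun x hx => key x fun y => ?_⟩
  exact (hb.eq y x).symm.trans (hx y)

end Signature

/-! ### Eigenvalues of real symmetric matrices and stability of the index -/

section Eigen

variable {n : ℕ} {a : Matrix (Fin n) (Fin n) ℝ}

/-- The eigenvalues of a real symmetric matrix in decreasing order. -/
def orderedEigenvalue (ha : a.IsHermitian) (k : Fin n) : ℝ :=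
  ha.eigenvalues₀ (Fin.cast (Fintype.card_fin n).symm k)

theorem orderedEigenvalue_antitone (ha : a.IsHermitian) : Antitone (orderedEigenvalue ha) :=
  fun _ _ h => ha.eigenvalues₀_antitone (Fin.cast_le_cast _ |>.2 h)

theorem exists_orthonormal_eigenvectors (ha : a.IsHermitian) :
    ∃ v : Fin n → Fin n → ℝ, (∀ k l, v k ⬝ᵥ v l = if k = l then 1 else 0) ∧
      ∀ k, a.mulVec (v k) = orderedEigenvalue ha k • v k := by
  -- The eigenvector basis is indexed through an unspecified bijection; `σ` matches it with the
  -- decreasing list of eigenvalues.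
  let σ : Fin n ≃ Fin n := (finCongr (Fintype.card_fin n).symm).trans
    (Fintype.equivOfCardEq (Fintype.card_fin _))
  have hσ : ∀ k, ha.eigenvalues (σ k) = orderedEigenvalue ha k := fun k => by
    simp [Matrix.IsHermitian.eigenvalues, orderedEigenvalue, σ]
  refine ⟨fun k => ha.eigenvectorBasis (σ k), fun k l => ?_, fun k => ?_⟩
  · have := orthonormal_iff_ite.1 ha.eigenvectorBasis.orthonormal (σ l) (σ k)
    simp only [EuclideanSpace.inner_eq_star_dotProduct, star_trivial, σ.injective.eq_iff] at this
    simpa [eq_comm] using this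
  · rw [← hσ]
    exact ha.mulVec_eigenvectorBasis (σ k)

theorem sum_smul_dotProduct_self {v : Fin n → Fin n → ℝ}
    (hv : ∀ k l, v k ⬝ᵥ v l = if k = l then 1 else 0) (c : Fin n → ℝ) :
    (∑ k, c k • v k) ⬝ᵥ (∑ k, c k • v k) = ∑ k, c k ^ 2 := by
  simp [sum_dotProduct, dotProduct_sum, hv, sq]

theorem sum_smul_dotProduct_mulVec {v : Fin n → Fin n → ℝ} {μ : Fin n → ℝ}
    (hv : ∀ k l, v k ⬝ᵥ v l = if k = l then 1 else 0) (hμ : ∀ k, a.mulVec (v k) = μ k • v k)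
    (c : Fin n → ℝ) :
    (∑ k, c k • v k) ⬝ᵥ a.mulVec (∑ k, c k • v k) = ∑ k, μ k * c k ^ 2 := by
  simp [Matrix.mulVec_sum, Matrix.mulVec_smul, hμ, sum_dotProduct, dotProduct_sum, hv]
  exact Finset.sum_congr rfl fun k _ => by ring

/-- The eigenvalue is the Rayleigh quotient at a unit eigenvector, whose entries are at most one in
modulus. This crude bound makes eigenvalues of a moderate net of matrices moderate. -/
theorem abs_orderedEigenvalue_le (ha : a.IsHermitian) (k : Fin n) :
    |orderedEigenvalue ha k| ≤ ∑ i, ∑ l, |a i l| := by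
  obtain ⟨v, hv, hμ⟩ := exists_orthonormal_eigenvectors ha
  have h1 : v k ⬝ᵥ a.mulVec (v k) = orderedEigenvalue ha k := by
    rw [hμ, dotProduct_smul, hv]
    simp
  have h2 : ∀ i, |v k i| ≤ 1 := fun i => by
    have h3 := hv k k
    simp only [dotProduct, if_true] at h3
    rw [← sq_le_one_iff_abs_le_one, sq, ← h3]
    exact Finset.single_le_sum (f := fun i => v k i * v k i) (fun i _ => mul_self_nonneg _)
      (Finset.mem_univ i)
  rw [← h1]
  simp only [dotProduct, Matrix.mulVec]
  refine (Finset.abs_sum_le_sum_abs _ _).trans (Finset.sum_le_sum fun i _ => ?_)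
  rw [abs_mul]
  refine (mul_le_of_le_one_left (abs_nonneg _) (h2 i)).trans
    ((Finset.abs_sum_le_sum_abs _ _).trans (Finset.sum_le_sum fun l _ => ?_))
  rw [abs_mul]
  exact mul_le_of_le_one_right (abs_nonneg _) (h2 l)

/-- A matrix with small entries defines a small quadratic form. -/
theorem abs_dotProduct_mulVec_le {d : Matrix (Fin n) (Fin n) ℝ} {δ : ℝ}
    (hd : ∀ i k, |d i k| ≤ δ) (x : Fin n → ℝ) :
    |x ⬝ᵥ d.mulVec x| ≤ n * δ * (x ⬝ᵥ x) := by
  simp only [dotProduct, Matrix.mulVec, Finset.mul_sum]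
  have h1 : ∀ i k, |x i * (d i k * x k)| ≤ δ * ((x i * x i + x k * x k) / 2) := fun i k => by
    have hδ : 0 ≤ δ := (abs_nonneg _).trans (hd i k)
    have : |x i * (d i k * x k)| = |d i k| * (|x i| * |x k|) := by
      simp only [abs_mul]; ring
    rw [this]
    refine mul_le_mul (hd i k) ?_ (by positivity) hδ
    nlinarith [sq_nonneg (|x i| - |x k|), abs_mul_abs_self (x i), abs_mul_abs_self (x k)]
  calc |∑ i, ∑ k, x i * (d i k * x k)|
      ≤ ∑ i, ∑ k, δ * ((x i * x i + x k * x k) / 2) :=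
        (Finset.abs_sum_le_sum_abs _ _).trans (Finset.sum_le_sum fun i _ =>
          (Finset.abs_sum_le_sum_abs _ _).trans (Finset.sum_le_sum fun k _ => h1 i k))
    _ = ∑ i, n * δ * (x i * x i) := by
        simp only [← Finset.mul_sum, ← Finset.sum_div, Finset.sum_add_distrib, Finset.sum_const,
          Finset.card_univ, Fintype.card_fin, nsmul_eq_mul]
        have : ∑ i, x i * (n * x i) = n * ∑ i, x i * x i := by
          rw [Finset.mul_sum]
          exact Finset.sum_congr rfl fun i _ => by ring
        rw [this]
        ring

/-- A quadratic form which, after a linear substitution, is given by a matrix close to a symmetric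
matrix with eigenvalues bounded away from zero is nondegenerate and has as many negative squares as
that matrix has negative eigenvalues. -/
theorem sigNeg_eq_ncard_eigenvalue_neg {V : Type*} [AddCommGroup V] [Module ℝ V]
    [FiniteDimensional ℝ V] (hV : Module.finrank ℝ V = n) (Q : QuadraticForm ℝ V)
    (F : (Fin n → ℝ) →ₗ[ℝ] V) {b : Matrix (Fin n) (Fin n) ℝ}
    (hF : ∀ x, Q (F x) = x ⬝ᵥ b.mulVec x) (ha : a.IsHermitian) {δ : ℝ} (hδ : 0 ≤ δ)
    (hab : ∀ i k, |b i k - a i k| ≤ δ) (hμ : ∀ k, n * δ < |orderedEigenvalue ha k|) :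
    sigNeg Q = {k | orderedEigenvalue ha k < 0}.ncard ∧ Q.radical = ⊥ := by
  obtain ⟨v, hv, hva⟩ := exists_orthonormal_eigenvectors ha
  refine sigNeg_eq_and_radical_eq_bot hV Q (F ∘ₗ Fintype.linearCombination ℝ v) _ (n * δ)
    (by positivity) hμ fun c => ?_
  rw [LinearMap.comp_apply, Fintype.linearCombination_apply, hF,
    ← sum_smul_dotProduct_mulVec hv hva c, ← sum_smul_dotProduct_self hv c, ← dotProduct_sub,
    ← Matrix.sub_mulVec]
  exact abs_dotProduct_mulVec_le hab _

end Eigen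

/-! ### Negligibility in terms of point values -/

section Analysis

/-- A Landau–Kolmogorov type interpolation: a step of length `h` in a unit direction changes `D` by
at most `2 * A`, while its linear approximation is off by at most `B * h * h`. Divide by `h`. -/
theorem norm_fderiv_le_of_bounds {E F : Type*} [NormedAddCommGroup E] [NormedSpace ℝ E]
    [NormedAddCommGroup F] [NormedSpace ℝ F] {D : E → F} {x : E} {h A B : ℝ} (hh : 0 < h)
    (hB : 0 ≤ B) (hD : ∀ z ∈ Metric.closedBall x h, DifferentiableAt ℝ D z)
    (hA : ∀ z ∈ Metric.closedBall x h, ‖D z‖ ≤ A)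
    (hL : ∀ z ∈ Metric.closedBall x h, ‖fderiv ℝ D z - fderiv ℝ D x‖ ≤ B * h) :
    ‖fderiv ℝ D x‖ ≤ 2 * A / h + B * h := by
  have hx : x ∈ Metric.closedBall x h := Metric.mem_closedBall_self hh.le
  have hA0 : 0 ≤ A := (norm_nonneg _).trans (hA x hx)
  refine ContinuousLinearMap.opNorm_le_of_unit_norm (by positivity) fun v hv => ?_
  have hxv : x + h • v ∈ Metric.closedBall x h := by
    simp [norm_smul, hv, abs_of_pos hh]
  have h1 := (convex_closedBall x h).norm_image_sub_le_of_norm_fderiv_le' (𝕜 := ℝ) hD hL hx hxv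
  rw [add_sub_cancel_left, map_smul, norm_smul h v, hv, mul_one, Real.norm_eq_abs,
    abs_of_pos hh] at h1
  have h2 : ‖h • fderiv ℝ D x v‖ ≤ 2 * A + B * h * h := by
    have := norm_sub_le (D (x + h • v) - D x) (D (x + h • v) - D x - h • fderiv ℝ D x v)
    rw [sub_sub_cancel] at this
    linarith [norm_sub_le (D (x + h • v)) (D x), hA _ hx, hA _ hxv]
  rw [norm_smul, Real.norm_eq_abs, abs_of_pos hh] at h2
  have h3 : 2 * A / h + B * h = (2 * A + B * h * h) / h := by field_simp
  rw [h3, le_div_iff₀ hh]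
  linarith

variable {n : ℕ} {Ω : Set (EuclideanSpace ℝ (Fin n))} {u : Idx → EuclideanSpace ℝ (Fin n) → ℝ}

/-- A moderate net whose values are uniformly negligible on compact sets is negligible together
with its derivatives. -/
theorem IsModerateOn.negligibleOn_of_zero_order (hΩ : IsOpen Ω)
    (su : ∀ ε, ContDiffOn ℝ ∞ (u ε) Ω) (hu : IsModerateOn Ω u)
    (h0 : ∀ K ⊆ Ω, IsCompact K → ∀ m : ℕ, ∃ C : ℝ, ∀ᶠ ε in toZero, ∀ y ∈ K,
      |u ε y| ≤ C * (ε : ℝ) ^ m) : IsNegligibleOn Ω u := by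
  intro K hK hKc k
  induction k generalizing K with
  | zero => simpa using h0 K hK hKc
  | succ k ih =>
    intro m
    obtain ⟨δ, hδ, hsub⟩ := hKc.exists_cthickening_subset_open hΩ hK
    -- Interpolate between order `k` (negligible) and order `k + 2` (moderate) with step `h = δ * ε
    -- ^ (N + m)`. Then `C * ε⁻¹ ^ N * h = C * δ * ε ^ m`, and decay `ε ^ (N + m + m)` at order `k`
    -- leaves `ε ^ m` after division by `h`. The factor `δ` keeps the ball inside the thickening of
    -- `K`.
    obtain ⟨N, C, hC⟩ := hu _ hsub hKc.cthickening (k + 2)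
    obtain ⟨D, hD⟩ := ih _ hsub hKc.cthickening (N + m + m)
    refine ⟨2 * D / δ + C * δ, ?_⟩
    filter_upwards [hC, hD] with ε hC hD x hx
    have hε : (ε : ℝ) ≠ 0 := ε.2.1.ne'
    have hpos : (0 : ℝ) < (ε : ℝ) ^ (N + m) := pow_pos ε.2.1 _
    have hle : (ε : ℝ) ^ (N + m) ≤ 1 := pow_le_one₀ ε.2.1.le ε.2.2
    have hball : Metric.closedBall x (δ * (ε : ℝ) ^ (N + m)) ⊆ Metric.cthickening δ K :=
      (Metric.closedBall_subset_closedBall (mul_le_of_le_one_right hδ.le hle)).trans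
        (Metric.closedBall_subset_cthickening hx δ)
    have hxb : x ∈ Metric.closedBall x (δ * (ε : ℝ) ^ (N + m)) :=
      Metric.mem_closedBall_self (by positivity)
    have hdiff : ∀ i : ℕ, ∀ z ∈ Metric.closedBall x (δ * (ε : ℝ) ^ (N + m)),
        DifferentiableAt ℝ (iteratedFDeriv ℝ i (u ε)) z := fun i z hz =>
      ((su ε).contDiffAt (hΩ.mem_nhds (hsub (hball hz)))).differentiableAt_iteratedFDeriv
        (mod_cast WithTop.coe_lt_top _)
    have hC0 : 0 ≤ C * ((ε : ℝ)⁻¹) ^ N := (norm_nonneg _).trans (hC x (hball hxb))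
    rw [← norm_fderiv_iteratedFDeriv]
    refine (norm_fderiv_le_of_bounds (h := δ * (ε : ℝ) ^ (N + m)) (A := D * (ε : ℝ) ^ (N + m + m))
      (B := C * ((ε : ℝ)⁻¹) ^ N) (by positivity) hC0 (hdiff k) (fun z hz => hD z (hball hz))
      fun z hz => ?_).trans_eq ?_
    · have h1 := (convex_closedBall x _).norm_image_sub_le_of_norm_fderiv_le (𝕜 := ℝ)
        (hdiff (k + 1)) (fun z hz => by
          rw [norm_fderiv_iteratedFDeriv]; exact hC z (hball hz)) hxb hz
      rw [fderiv_iteratedFDeriv]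
      simp only [Function.comp_apply]
      rw [← dist_eq_norm, LinearIsometryEquiv.dist_map, dist_eq_norm]
      exact h1.trans (mul_le_mul_of_nonneg_left (mem_closedBall_iff_norm.1 hz) hC0)
    · rw [pow_add _ (N + m) m, inv_pow, pow_add]
      field_simp

/-- A net of continuous functions with negligible point values is uniformly negligible on compact
sets. -/
theorem uniform_negligible_of_point_values (su : ∀ ε, ContinuousOn (u ε) Ω)
    (h : ∀ x : PointNet Ω, IsNegligible fun ε => u ε (x.1 ε)) (K : Set _) (hK : K ⊆ Ω)
    (hKc : IsCompact K) (m : ℕ) :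
    ∃ C : ℝ, ∀ᶠ ε in toZero, ∀ y ∈ K, |u ε y| ≤ C * (ε : ℝ) ^ m := by
  rcases K.eq_empty_or_nonempty with rfl | hne
  · exact ⟨0, by simp⟩
  -- Points where the supremum over `K` is attained form a compactly supported net, so its point
  -- value controls the whole of `K`.
  have hmax : ∀ ε, ∃ x ∈ K, ∀ y ∈ K, |u ε y| ≤ |u ε x| := fun ε =>
    hKc.exists_isMaxOn hne ((su ε).mono hK).abs
  choose x hx hmax using hmax
  obtain ⟨C, hC⟩ := h ⟨x, fun ε => hK (hx ε), K, hK, hKc, Filter.Eventually.of_forall hx⟩ m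
  exact ⟨C, hC.mono fun ε hε y hy => (hmax ε y hy).trans hε⟩

theorem IsModerateOn.negligibleOn_of_point_values (hΩ : IsOpen Ω)
    (su : ∀ ε, ContDiffOn ℝ ∞ (u ε) Ω) (hu : IsModerateOn Ω u)
    (h : ∀ x : PointNet Ω, IsNegligible fun ε => u ε (x.1 ε)) : IsNegligibleOn Ω u :=
  hu.negligibleOn_of_zero_order hΩ su
    (uniform_negligible_of_point_values (fun ε => (su ε).continuousOn) h)

theorem IsModerateOn.const_mul (hΩ : IsOpen Ω) (su : ∀ ε, ContDiffOn ℝ ∞ (u ε) Ω)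
    (hu : IsModerateOn Ω u) (c : ℝ) : IsModerateOn Ω fun ε => c • u ε := by
  intro K hK hKc k
  obtain ⟨N, C, h⟩ := hu K hK hKc k
  refine ⟨N, |c| * C, h.mono fun ε hε y hy => ?_⟩
  rw [iteratedFDeriv_const_smul_apply
    (((su ε).contDiffAt (hΩ.mem_nhds (hK hy))).of_le (mod_cast le_top)), norm_smul, mul_assoc]
  exact mul_le_mul_of_nonneg_left (hε y hy) (abs_nonneg c)

end Analysis

/-! ### Symmetrization of tensor fields -/

section Flip

variable {n : ℕ} {X : Type*} [TopologicalSpace X] [ChartedSpace (EuclideanSpace ℝ (Fin n)) X]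
  [IsManifold (𝓡 n) ∞ X]

/-- The tensor field with its two arguments exchanged. -/
def flipTensor (s : SmoothTensor n X) : SmoothTensor n X where
  toFun p := (show EuclideanSpace ℝ (Fin n) →L[ℝ] EuclideanSpace ℝ (Fin n) →L[ℝ] ℝ from s p).flip
  contMDiff_toFun := by
    intro p
    have h := s.contMDiff p
    rw [contMDiffAt_hom_bundle] at h ⊢
    refine ⟨h.1, ?_⟩
    -- In trivialization coordinates near `p`, exchanging the arguments is a fixed linear isometry
    -- of the model space of bilinear maps, hence smooth.
    have hflip : ContDiff ℝ ∞ (ContinuousLinearMap.flipₗᵢ ℝ (EuclideanSpace ℝ (Fin n))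
      (EuclideanSpace ℝ (Fin n)) ℝ) := LinearIsometryEquiv.contDiff _
    refine (hflip.contMDiff.contMDiffAt.comp p h.2).congr_of_eventuallyEq ?_
    have hbase := (trivializationAt (EuclideanSpace ℝ (Fin n)) (TangentSpace (𝓡 n)) p).open_baseSet.mem_nhds
      (FiberBundle.mem_baseSet_trivializationAt' p)
    filter_upwards [hbase] with q hq
    have key : ∀ (f : TangentSpace (𝓡 n) q →L[ℝ] TangentSpace (𝓡 n) q →L[ℝ] ℝ)
        (v w : EuclideanSpace ℝ (Fin n)),
        ContinuousLinearMap.inCoordinates (EuclideanSpace ℝ (Fin n)) (TangentSpace (𝓡 n))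
          (EuclideanSpace ℝ (Fin n) →L[ℝ] ℝ) (fun b : X => TangentSpace (𝓡 n) b →L[ℝ] ℝ)
          p q p q f v w =
        f ((trivializationAt (EuclideanSpace ℝ (Fin n)) (TangentSpace (𝓡 n)) p).symm q v)
          ((trivializationAt (EuclideanSpace ℝ (Fin n)) (TangentSpace (𝓡 n)) p).symm q w) :=
      fun f v w => by
        have := inCoordinates_apply_eq₂ (F₃ := ℝ) (E₃ := Bundle.Trivial X ℝ) (ϕ := f) (v := v)
          (w := w) hq hq (by simp)
        simpa using this
    ext v w
    exact (key _ v w).trans (key (s q) w v).symm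

/-- The symmetric part of a tensor field. -/
def symmPart (s : SmoothTensor n X) : SmoothTensor n X := (1 / 2 : ℝ) • (s + flipTensor s)

theorem component_symmPart (s : SmoothTensor n X)
    (φ : OpenPartialHomeomorph X (EuclideanSpace ℝ (Fin n))) (i k : Fin n) :
    component (symmPart s) φ i k =
      (1 / 2 : ℝ) • (component s φ i k + component s φ k i) := rfl

theorem formAt_symmPart_isSymm (s : SmoothTensor n X) (p : X) :
    (formAt (symmPart s) p).IsSymm := by
  refine ⟨fun v w => ?_⟩
  change (1 / 2 : ℝ) • (s p v w + s p w v) = (1 / 2 : ℝ) • (s p w v + s p v w)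
  rw [add_comm]

end Flip

/-! ### Symmetric matrices over the generalized numbers -/

section GeneralizedMatrices

variable {n : ℕ} {A : Matrix (Fin n) (Fin n) GReal} {a : Idx → Matrix (Fin n) (Fin n) ℝ}

theorem isModerate_orderedEigenvalue (ha : ∀ ε, (a ε).IsHermitian)
    (hA : ∀ i k, Represents (fun ε => a ε i k) (A i k)) (k : Fin n) :
    IsModerate fun ε => orderedEigenvalue (ha ε) k := by
  have h : IsModerate (∑ i, ∑ l, fun ε => |a ε i l|) :=
    IsModerate.sum _ fun i _ => IsModerate.sum _ fun l _ => (hA i l).1.abs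
  refine h.of_abs_le (Filter.Eventually.of_forall fun ε => ?_)
  refine (abs_orderedEigenvalue_le (ha ε) k).trans ((le_of_eq ?_).trans (le_abs_self _))
  simp [Finset.sum_apply]

/-- The eigenvalues of a representative of a nondegenerate symmetric matrix are bounded below by a
power of `ε`. -/
theorem exists_pow_le_abs_eigenvalue (ha : ∀ ε, (a ε).IsHermitian)
    (hA : ∀ i k, Represents (fun ε => a ε i k) (A i k)) (hnd : (Matrix.toBilin' A).Nondegenerate) :
    ∃ m : ℕ, ∀ᶠ ε : Idx in toZero, ∀ k, (ε : ℝ) ^ m ≤ |orderedEigenvalue (ha ε) k| := by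
  classical
  by_contra! hcon
  obtain ⟨S, hS, hSm⟩ := exists_frequently_mem_of_antitone
    (P := fun m ε => ∃ k, |orderedEigenvalue (ha ε) k| < (ε : ℝ) ^ m)
    (fun m k ε hmk ⟨i, hi⟩ => ⟨i, hi.trans_le (pow_le_pow_of_le_one ε.2.1.le ε.2.2 hmk)⟩)
    (fun m => by simpa using hcon m)
  have : Nonempty (Fin n) := by
    obtain ⟨ε, h1, h2⟩ := (hS.and_eventually (hSm 0)).exists
    exact (h2 h1).nonempty
  -- `κ ε` marks the eigenvalue of least modulus; along `S` it is eventually smaller than every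
  -- power of `ε`.
  choose κ hκ using fun ε => Finite.exists_min fun k => |orderedEigenvalue (ha ε) k|
  choose v hv hva using fun ε => exists_orthonormal_eigenvectors (ha ε)
  have hvle : ∀ ε k i, |v ε k i| ≤ 1 := fun ε k i => by
    have h := hv ε k k
    simp only [dotProduct, if_true] at h
    rw [← sq_le_one_iff_abs_le_one, sq, ← h]
    exact Finset.single_le_sum (f := fun i => v ε k i * v ε k i) (fun i _ => mul_self_nonneg _)
      (Finset.mem_univ i)
  -- The unit eigenvector for that eigenvalue on `S`, and zero elsewhere. Its class is killed by
  -- `A`, so nondegeneracy makes it zero; yet its squared length is one on `S`, which accumulates at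
  -- `0`.
  let w : Fin n → Idx → ℝ := fun i ε => if ε ∈ S then v ε (κ ε) i else 0
  have hwm : ∀ i, IsModerate (w i) := fun i => (isModerate_const 1).of_abs_le <|
    Filter.Eventually.of_forall fun ε => by
      by_cases h : ε ∈ S
      · simpa [w, h] using hvle ε (κ ε) i
      · simp [w, h]
  have hzero : ∀ i, (∑ k, A i k * GReal.mk (w k) (hwm k)) = 0 := fun i => by
    have hrep := Represents.sum Finset.univ fun k _ =>
      (hA i k).mul (⟨hwm k, rfl⟩ : Represents (w k) (GReal.mk (w k) (hwm k)))
    refine hrep.eq_zero_iff.2 fun m => ⟨1, ?_⟩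
    filter_upwards [hSm m] with ε hε
    rw [Finset.sum_apply]
    by_cases h : ε ∈ S
    · have h1 := congrFun (hva ε (κ ε)) i
      simp only [Matrix.mulVec, dotProduct, Pi.smul_apply, smul_eq_mul] at h1
      simp only [Pi.mul_apply, w, h, if_true, h1, one_mul, abs_mul]
      obtain ⟨k, hk⟩ := hε h
      exact (mul_le_of_le_one_right (abs_nonneg _) (hvle ε (κ ε) i)).trans
        ((hκ ε k).trans hk.le)
    · simp only [Pi.mul_apply, w, h, if_false, mul_zero, Finset.sum_const_zero, abs_zero, one_mul]
      exact pow_nonneg ε.2.1.le m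
  have hW : (fun k => GReal.mk (w k) (hwm k)) = 0 := by
    refine hnd.2 _ fun x => ?_
    rw [Matrix.toBilin'_apply]
    refine Finset.sum_eq_zero fun i _ => ?_
    simp only [mul_assoc, ← Finset.mul_sum, hzero, mul_zero]
  have hsum : IsNegligible (∑ i, w i * w i) := by
    refine (Represents.eq_zero_iff (a := ∑ i : Fin n, 0 * 0) (Represents.sum _ fun i _ => ?_)).1
      (by simp)
    have h0 : Represents (w i) 0 := ⟨hwm i, congrFun hW i⟩
    exact h0.mul h0
  obtain ⟨ε, h1, h2⟩ := (hS.and_eventually (hsum.eventually_lt one_pos 0)).exists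
  have h3 := hv ε (κ ε) (κ ε)
  simp only [dotProduct, if_true] at h3
  simp only [Finset.sum_apply, Pi.mul_apply, w, h1, if_true, h3] at h2
  norm_num at h2

/-- As eigenvalues decrease, the positions of the negative ones form an upper set of `Fin n`. Upper
sets of a linear order are nested, so the cardinality `j` fixes the set, and each position has the
same sign for all small `ε`. -/
theorem matrixHasIndex_of_eventually {j m : ℕ} (hsymm : A.IsSymm) (ha : ∀ ε, (a ε).IsHermitian)
    (hA : ∀ i k, Represents (fun ε => a ε i k) (A i k))
    (hm : ∀ᶠ ε : Idx in toZero, ∀ k, (ε : ℝ) ^ m ≤ |orderedEigenvalue (ha ε) k|)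
    (hj : ∀ᶠ ε : Idx in toZero, {k | orderedEigenvalue (ha ε) k < 0}.ncard = j) :
    MatrixHasIndex A j := by
  have hup : ∀ ε, IsUpperSet {k | orderedEigenvalue (ha ε) k < 0} := fun ε k l hkl hk =>
    (orderedEigenvalue_antitone (ha ε) hkl).trans_lt hk
  obtain ⟨ε₀, hε₀⟩ := hj.exists
  set S := {k | orderedEigenvalue (ha ε₀) k < 0} with hSdef
  have hS : ∀ᶠ ε : Idx in toZero, {k | orderedEigenvalue (ha ε) k < 0} = S := by
    filter_upwards [hj] with ε hε
    rcases (hup ε).total (hup ε₀) with h | h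
    · exact Set.eq_of_subset_of_ncard_le h (by rw [hε, hε₀]) (Set.toFinite _)
    · exact (Set.eq_of_subset_of_ncard_le h (by rw [hε, hε₀]) (Set.toFinite _)).symm
  have hmod := isModerate_orderedEigenvalue ha hA
  have hneg : ∀ k ∈ S, StrictlyNeg (GReal.mk _ (hmod k)) := fun k hk =>
    Represents.strictlyNeg ⟨hmod k, rfl⟩ m <| by
      filter_upwards [hS, hm] with ε h1 h2
      have h3 : orderedEigenvalue (ha ε) k < 0 := h1.symm.subset hk
      linarith [h2 k, abs_of_neg h3]
  have hpos : ∀ k ∉ S, StrictlyPos (GReal.mk _ (hmod k)) := fun k hk =>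
    Represents.strictlyPos ⟨hmod k, rfl⟩ m <| by
      filter_upwards [hS, hm] with ε h1 h2
      have h3 : ¬orderedEigenvalue (ha ε) k < 0 := fun h => hk (h1.subset h)
      linarith [h2 k, abs_of_nonneg (not_lt.1 h3)]
  have hN : {k | StrictlyNeg (GReal.mk _ (hmod k))} = S := by
    ext k
    refine ⟨fun hk => ?_, hneg k⟩
    by_contra h
    exact (hpos k h).not_strictlyNeg hk
  have hP : {k | StrictlyPos (GReal.mk _ (hmod k))} = Sᶜ := by
    ext k
    exact ⟨fun hk h => hk.not_strictlyNeg (hneg k h), hpos k⟩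
  refine ⟨hsymm, fun k => GReal.mk _ (hmod k), ⟨a, ha, hA, fun k => ⟨hmod k, rfl⟩⟩, ?_, ?_⟩
  · rw [hN, hP, add_comm, Set.ncard_add_ncard_compl, Nat.card_fin]
  · rw [hN, hε₀]

theorem MatrixHasIndex.exists_representative {j : ℕ} (h : MatrixHasIndex A j) :
    ∃ (a : Idx → Matrix (Fin n) (Fin n) ℝ) (ha : ∀ ε, (a ε).IsHermitian),
      (∀ i k, Represents (fun ε => a ε i k) (A i k)) ∧ ∃ m : ℕ, ∀ᶠ ε : Idx in toZero,
        (∀ k, (ε : ℝ) ^ m ≤ |orderedEigenvalue (ha ε) k|) ∧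
        {k | orderedEigenvalue (ha ε) k < 0}.ncard = j := by
  obtain ⟨-, θ, ⟨a, ha, hA, hθ⟩, hn, hj⟩ := h
  refine ⟨a, ha, hA, ?_⟩
  -- The two sign sets are disjoint and their cardinalities add up to `n`.
  have hcompl : {k | StrictlyPos (θ k)} = {k | StrictlyNeg (θ k)}ᶜ := by
    refine Set.eq_of_subset_of_ncard_le (fun k hk => hk.not_strictlyNeg) ?_ (Set.toFinite _)
    have := Set.ncard_add_ncard_compl {k | StrictlyNeg (θ k)}
    rw [Nat.card_fin] at this
    omega
  have hk : ∀ k, ∃ m : ℕ, ∀ᶠ ε : Idx in toZero, (ε : ℝ) ^ m ≤ |orderedEigenvalue (ha ε) k| ∧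
      (orderedEigenvalue (ha ε) k < 0 ↔ StrictlyNeg (θ k)) := fun k => by
    by_cases hk : StrictlyNeg (θ k)
    · obtain ⟨m, hm⟩ := (hθ k).exists_le_neg_pow_of_strictlyNeg hk
      refine ⟨m, hm.mono fun ε (hε : orderedEigenvalue (ha ε) k ≤ _) => ?_⟩
      have hlt := pow_pos ε.2.1 m
      have h0 : orderedEigenvalue (ha ε) k < 0 := by linarith
      exact ⟨by rw [abs_of_neg h0]; linarith, by simp [h0, hk]⟩
    · have hp : StrictlyPos (θ k) := hcompl.symm.subset hk
      obtain ⟨m, hm⟩ := (hθ k).exists_pow_le_of_strictlyPos hp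
      refine ⟨m, hm.mono fun ε (hε : _ ≤ orderedEigenvalue (ha ε) k) => ?_⟩
      exact ⟨hε.trans (le_abs_self _), by
        simp only [hk, iff_false, not_lt]; exact (pow_pos ε.2.1 m).le.trans hε⟩
  choose m hm using hk
  -- Since `ε ≤ 1`, the sum of the exponents serves all eigenvalues at once.
  refine ⟨∑ k, m k, (Filter.eventually_all.2 hm).mono fun ε hε => ⟨fun k => ?_, ?_⟩⟩
  · exact (pow_le_pow_of_le_one ε.2.1.le ε.2.2
      (Finset.single_le_sum (fun _ _ => Nat.zero_le _) (Finset.mem_univ k))).trans (hε k).1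
  · rw [← hj]
    congr 1
    ext k
    exact (hε k).2

end GeneralizedMatrices

/-! ### Generalized tensors in charts -/

section Charts

variable {n : ℕ} {X : Type*} [TopologicalSpace X] [ChartedSpace (EuclideanSpace ℝ (Fin n)) X]
  [IsManifold (𝓡 n) ∞ X]

instance finiteDimensionalTangentSpace (p : X) : FiniteDimensional ℝ (TangentSpace (𝓡 n) p) :=
  inferInstanceAs (FiniteDimensional ℝ (EuclideanSpace ℝ (Fin n)))

omit [IsManifold (𝓡 n) ∞ X] in
theorem finrank_tangentSpace (p : X) : Module.finrank ℝ (TangentSpace (𝓡 n) p) = n :=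
  finrank_euclideanSpace_fin (𝕜 := ℝ) (n := n)

/-- The matrix of components of a tensor field in a chart. -/
def componentMatrix (s : SmoothTensor n X)
    (φ : OpenPartialHomeomorph X (EuclideanSpace ℝ (Fin n))) (y : EuclideanSpace ℝ (Fin n)) :
    Matrix (Fin n) (Fin n) ℝ := Matrix.of fun i k => component s φ i k y

/-- The linear map to the tangent space defined by the coordinate frame of a chart. -/
def frameMap (φ : OpenPartialHomeomorph X (EuclideanSpace ℝ (Fin n)))
    (y : EuclideanSpace ℝ (Fin n)) : (Fin n → ℝ) →ₗ[ℝ] TangentSpace (𝓡 n) (φ.symm y) :=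
  Fintype.linearCombination ℝ fun i =>
    (mfderiv (𝓡 n) (𝓡 n) φ.symm y (EuclideanSpace.single i (1 : ℝ)) :
      TangentSpace (𝓡 n) (φ.symm y))

theorem formAt_frameMap (s : SmoothTensor n X)
    (φ : OpenPartialHomeomorph X (EuclideanSpace ℝ (Fin n))) (y : EuclideanSpace ℝ (Fin n))
    (c : Fin n → ℝ) :
    LinearMap.BilinMap.toQuadraticMap (formAt s (φ.symm y)) (frameMap φ y c) =
      c ⬝ᵥ (componentMatrix s φ y).mulVec c := by
  rw [LinearMap.BilinMap.toQuadraticMap_apply, frameMap, Fintype.linearCombination_apply]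
  simp only [map_sum, map_smul, LinearMap.sum_apply, LinearMap.smul_apply, smul_eq_mul, dotProduct,
    Matrix.mulVec, Finset.mul_sum]
  rw [Finset.sum_comm]
  refine Finset.sum_congr rfl fun i _ => Finset.sum_congr rfl fun k _ => ?_
  change c k * (c i * component s φ i k y) = c i * (component s φ i k y * c k)
  ring

theorem componentMatrix_symm {s : SmoothTensor n X}
    {φ : OpenPartialHomeomorph X (EuclideanSpace ℝ (Fin n))} {y : EuclideanSpace ℝ (Fin n)}
    (h : (formAt s (φ.symm y)).IsSymm) (i k : Fin n) :
    componentMatrix s φ y i k = componentMatrix s φ y k i :=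
  h.eq _ _

/-- The class of a net of points. -/
def PointNet.toGenPoint {Ω : Set (EuclideanSpace ℝ (Fin n))} (x : PointNet Ω) : GenPoint Ω :=
  Quotient.mk (pointSetoid Ω) x

variable {s : Idx → SmoothTensor n X} {g : GenTensor n X}
  {φ : OpenPartialHomeomorph X (EuclideanSpace ℝ (Fin n))}

theorem TensorRepresents.represents_component (hs : TensorRepresents s g)
    (hφ : φ ∈ IsManifold.maximalAtlas (𝓡 n) ∞ X) (x : PointNet φ.target) (i k : Fin n) :
    Represents (fun ε => componentMatrix (s ε) φ (x.1 ε) i k)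
      (componentAt g φ hφ x.toGenPoint i k) := by
  obtain ⟨hs, rfl⟩ := hs
  exact ⟨(hs φ hφ i k).comp_point x, rfl⟩

theorem componentAt_symm {hφ : φ ∈ IsManifold.maximalAtlas (𝓡 n) ∞ X} {x : GenPoint φ.target}
    (h : (evalForm g φ hφ x).IsSymm) (i k : Fin n) :
    componentAt g φ hφ x i k = componentAt g φ hφ x k i := by
  have := h.eq (Pi.single i 1) (Pi.single k 1)
  simpa [evalForm, Matrix.toBilin'_single] using this

/-- Symmetry of `g` at generalized points only says that the antisymmetric part of a representative
has negligible point values. For a moderate net this already forces negligibility in every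
derivative, so that part can be dropped. -/
theorem TensorRepresents.symmPart (hs : TensorRepresents s g)
    (h : ∀ (φ : OpenPartialHomeomorph X (EuclideanSpace ℝ (Fin n)))
      (hφ : φ ∈ IsManifold.maximalAtlas (𝓡 n) ∞ X) (x : GenPoint φ.target),
      (evalForm g φ hφ x).IsSymm) :
    TensorRepresents (fun ε => symmPart (s ε)) g := by
  have hrep := hs
  obtain ⟨hs, rfl⟩ := hs
  have smooth := fun (φ : OpenPartialHomeomorph X (EuclideanSpace ℝ (Fin n)))
    (hφ : φ ∈ IsManifold.maximalAtlas (𝓡 n) ∞ X) (i k : Fin n) (ε : Idx) =>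
      contDiffOn_component (s ε) hφ i k
  have hmod : (fun ε => Colombeau.symmPart (s ε)) ∈ moderateTensors n X := fun φ hφ i k =>
    ((hs φ hφ i k).add φ.open_target (smooth φ hφ i k) (smooth φ hφ k i)
      (hs φ hφ k i)).const_mul φ.open_target
        (fun ε => (smooth φ hφ i k ε).add (smooth φ hφ k i ε)) (1 / 2)
  refine ⟨hmod, QuotientAddGroup.eq.2 fun φ hφ i k => ?_⟩
  have hdiff : ∀ ε, component ((-(⟨_, hmod⟩ : moderateTensors n X) + ⟨s, hs⟩).1 ε) φ i k =
      (1 / 2 : ℝ) • (component (s ε) φ i k + -component (s ε) φ k i) := fun ε => by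
    change -component (Colombeau.symmPart (s ε)) φ i k + component (s ε) φ i k = _
    rw [component_symmPart]
    module
  simp only [hdiff]
  refine IsModerateOn.negligibleOn_of_point_values φ.open_target
    (fun ε => contDiffOn_const.smul ((smooth φ hφ i k ε).add (smooth φ hφ k i ε).neg))
    (((hs φ hφ i k).add φ.open_target (smooth φ hφ i k) (fun ε => (smooth φ hφ k i ε).neg)
      (hs φ hφ k i).neg).const_mul φ.open_target
        (fun ε => (smooth φ hφ i k ε).add (smooth φ hφ k i ε).neg) (1 / 2)) fun x => ?_
  have h1 := hrep.represents_component hφ x i k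
  rw [componentAt_symm (h φ hφ _)] at h1
  have h2 := h1.negligible_sub (hrep.represents_component hφ x k i)
  refine ((isModerate_const (1 / 2)).mul_negligible h2).of_abs_le
    (Filter.Eventually.of_forall fun ε => le_of_eq ?_)
  simp [componentMatrix, sub_eq_add_neg]

/-- A generalized metric of constant index has that index at each generalized point. -/
theorem TensorHasIndex.formHasIndex [T2Space X] {j : ℕ} (hT : TensorHasIndex g j)
    (hφ : φ ∈ IsManifold.maximalAtlas (𝓡 n) ∞ X) (x : GenPoint φ.target)
    (hg : (evalForm g φ hφ x).IsSymm ∧ (evalForm g φ hφ x).Nondegenerate) :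
    FormHasIndex (evalForm g φ hφ x) j := by
  have : LocallyCompactSpace X := ChartedSpace.locallyCompactSpace (EuclideanSpace ℝ (Fin n)) X
  obtain ⟨y, rfl⟩ := Quotient.exists_rep x
  change FormHasIndex (evalForm g φ hφ y.toGenPoint) j
  change (evalForm g φ hφ y.toGenPoint).IsSymm ∧ (evalForm g φ hφ y.toGenPoint).Nondegenerate at hg
  obtain ⟨K, hK, hKc, hy⟩ := y.2.2
  obtain ⟨V, hVo, hKV, hVc⟩ := exists_isOpen_superset_and_isCompact_closure
    (hKc.image_of_continuousOn (φ.continuousOn_symm.mono hK))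
  obtain ⟨s, hs, ε₀, hε₀, hV⟩ := hT V hVo hVc
  set A : Matrix (Fin n) (Fin n) GReal :=
    Matrix.of fun i k => componentAt g φ hφ y.toGenPoint i k with hAdef
  -- A symmetric representative must be symmetric for every `ε`, whereas the component matrix is
  -- known to be so only for small `ε`; symmetrizing changes nothing there.
  let a : Idx → Matrix (Fin n) (Fin n) ℝ := fun ε =>
    (1 / 2 : ℝ) • (componentMatrix (s ε) φ (y.1 ε) + (componentMatrix (s ε) φ (y.1 ε)).transpose)
  have ha : ∀ ε, (a ε).IsHermitian := fun ε => by
    ext i k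
    simp [a, add_comm]
  have hAsymm : A.IsSymm := Matrix.IsSymm.ext fun i k => componentAt_symm hg.1 _ _
  have hgood : ∀ᶠ ε in toZero, IsPseudoRiemannianOn (s ε) V j ∧ φ.symm (y.1 ε) ∈ V := by
    filter_upwards [eventually_lt_toZero hε₀, hy] with ε h1 h2
    exact ⟨hV ε h1, hKV ⟨_, h2, rfl⟩⟩
  have haM : ∀ᶠ ε in toZero, a ε = componentMatrix (s ε) φ (y.1 ε) := by
    filter_upwards [hgood] with ε ⟨h1, h2⟩
    ext i k
    simp only [a, Matrix.smul_apply, Matrix.add_apply, Matrix.transpose_apply, smul_eq_mul]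
    rw [componentMatrix_symm (h1 _ h2).1 k i]
    ring
  have hA : ∀ i k, Represents (fun ε => a ε i k) (A i k) := fun i k => by
    have hr := hs.represents_component hφ y i k
    refine hr.of_negligible_sub (hr.1.of_abs_le ?_) fun m => ⟨0, ?_⟩
    · filter_upwards [haM] with ε h
      rw [h]
    · filter_upwards [haM] with ε h
      simp [h]
  obtain ⟨m, hm⟩ := exists_pow_le_abs_eigenvalue ha hA hg.2
  refine ⟨hg.1, Pi.basisFun GReal (Fin n), ?_⟩
  have hbasis : (Matrix.of fun i k => evalForm g φ hφ y.toGenPoint (Pi.basisFun GReal (Fin n) i)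
      (Pi.basisFun GReal (Fin n) k)) = A := by
    ext i k
    simp [evalForm, A, Matrix.toBilin'_single]
  rw [hbasis]
  refine matrixHasIndex_of_eventually hAsymm ha hA hm ?_
  filter_upwards [hgood, haM, hm] with ε ⟨h1, h2⟩ h3 h4
  rw [← (h1 _ h2).2.2]
  -- Here `a ε` is exactly the component matrix, so the tolerance is `δ = 0`.
  exact (sigNeg_eq_ncard_eigenvalue_neg (finrank_tangentSpace _) _ (frameMap φ (y.1 ε))
    (formAt_frameMap (s ε) φ (y.1 ε)) (ha ε) le_rfl (fun i k => by simp [h3])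
    fun k => by simpa using (pow_pos ε.2.1 m).trans_le (h4 k)).1.symm

/-- If the value of a generalized tensor at a generalized point has index `j`, so have the values
of a symmetric representative for small `ε`. -/
theorem FormHasIndex.eventually {j : ℕ} (hs : TensorRepresents s g)
    (hsymm : ∀ ε p, (formAt (s ε) p).IsSymm) (hφ : φ ∈ IsManifold.maximalAtlas (𝓡 n) ∞ X)
    (x : PointNet φ.target) (h : FormHasIndex (evalForm g φ hφ x.toGenPoint) j) :
    ∀ᶠ ε in toZero, IsPseudoRiemannianOn (s ε) {φ.symm (x.1 ε)} j := by
  obtain ⟨-, e, he⟩ := h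
  obtain ⟨a, ha, hA, m, hm⟩ := he.exists_representative
  choose E hE using fun i k => Represents.exists_of (e i k)
  -- The Gram matrix of the actual tensor in representatives of the basis vectors. It differs
  -- negligibly from `a`, the representative carrying the eigenvalue information.
  let b : Idx → Matrix (Fin n) (Fin n) ℝ := fun ε =>
    (Matrix.of fun i k => E i k ε) * componentMatrix (s ε) φ (x.1 ε) *
      (Matrix.of fun i k => E i k ε).transpose
  have hb : ∀ i k, Represents (fun ε => b ε i k)
      (evalForm g φ hφ x.toGenPoint (e i) (e k)) := fun i k => by
    have h1 := Represents.sum Finset.univ fun p _ => Represents.sum Finset.univ fun q _ =>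
      ((hE i p).mul (hs.represents_component hφ x p q)).mul (hE k q)
    rw [evalForm, Matrix.toBilin'_apply]
    simp only [Matrix.of_apply]
    convert h1 using 1
    ext ε
    simp only [b, Matrix.mul_apply, Finset.sum_apply, Pi.mul_apply, Matrix.of_apply,
      Matrix.transpose_apply, Finset.sum_mul]
    exact Finset.sum_comm
  -- The factor `1 / (n + 1)` makes `n` times the entrywise error smaller than the spectral gap `ε ^
  -- m`.
  have hclose : ∀ᶠ ε : Idx in toZero, ∀ i k,
      |b ε i k - a ε i k| < 1 / ((n : ℝ) + 1) * (ε : ℝ) ^ m :=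
    Filter.eventually_all.2 fun i => Filter.eventually_all.2 fun k =>
      ((hb i k).negligible_sub (hA i k)).eventually_lt (by positivity) m
  filter_upwards [hclose, hm] with ε h1 ⟨h2, h3⟩
  rintro _ rfl
  have hpos := pow_pos ε.2.1 m
  obtain ⟨h4, h5⟩ := sigNeg_eq_ncard_eigenvalue_neg (finrank_tangentSpace _)
    (LinearMap.BilinMap.toQuadraticMap (formAt (s ε) (φ.symm (x.1 ε))))
    (frameMap φ (x.1 ε) ∘ₗ (Matrix.of fun i k => E i k ε).transpose.mulVecLin) (b := b ε)
    (fun c => by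
      rw [LinearMap.comp_apply, formAt_frameMap, Matrix.mulVecLin_apply, Matrix.mulVec_transpose,
        ← Matrix.dotProduct_mulVec, ← Matrix.mulVec_transpose, Matrix.mulVec_mulVec,
        Matrix.mulVec_mulVec])
    (ha ε) (by positivity) (fun i k => (h1 i k).le) fun k => by
      refine lt_of_lt_of_le ?_ (h2 k)
      rw [← mul_assoc]
      refine mul_lt_of_lt_one_left hpos ?_
      rw [mul_one_div, div_lt_one (by positivity)]
      exact lt_add_one _
  exact ⟨hsymm ε _, nondegenerate_of_radical_eq_bot (hsymm ε _) h5, h4.trans h3⟩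

theorem eventually_isPseudoRiemannianOn_image {j : ℕ} (hs : TensorRepresents s g)
    (hsymm : ∀ ε p, (formAt (s ε) p).IsSymm) (hφ : φ ∈ IsManifold.maximalAtlas (𝓡 n) ∞ X)
    (h : ∀ x : GenPoint φ.target, FormHasIndex (evalForm g φ hφ x) j)
    {K : Set (EuclideanSpace ℝ (Fin n))} (hK : K ⊆ φ.target) (hKc : IsCompact K) :
    ∀ᶠ ε in toZero, IsPseudoRiemannianOn (s ε) (φ.symm '' K) j := by
  rcases K.eq_empty_or_nonempty with rfl | ⟨y₀, hy₀⟩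
  · exact Filter.Eventually.of_forall fun ε p hp => by simp at hp
  -- For each `ε` pick a point of `K` where the property fails, if there is one. The property along
  -- this single net of points then gives it on all of `K`, turning pointwise information into
  -- uniform information.
  have hex : ∀ ε, ∃ y ∈ K, IsPseudoRiemannianOn (s ε) {φ.symm y} j →
      IsPseudoRiemannianOn (s ε) (φ.symm '' K) j := fun ε => by
    by_contra! hcon
    refine (hcon y₀ hy₀).2 ?_
    rintro _ ⟨y, hy, rfl⟩
    exact (hcon y hy).1 _ rfl
  choose y hy hyK using hex
  exact (FormHasIndex.eventually hs hsymm hφ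
    ⟨y, fun ε => hK (hy ε), K, hK, hKc, Filter.Eventually.of_forall hy⟩ (h _)).mono hyK

theorem tensorHasIndex_of_formHasIndex {j : ℕ} (hg : IsSymmNondegenerate g)
    (h : ∀ (φ : OpenPartialHomeomorph X (EuclideanSpace ℝ (Fin n)))
      (hφ : φ ∈ IsManifold.maximalAtlas (𝓡 n) ∞ X) (x : GenPoint φ.target),
      FormHasIndex (evalForm g φ hφ x) j) : TensorHasIndex g j := by
  intro V _ hVc
  have : LocallyCompactSpace X := ChartedSpace.locallyCompactSpace (EuclideanSpace ℝ (Fin n)) X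
  obtain ⟨⟨s, hs⟩, hsg⟩ := QuotientAddGroup.mk_surjective g
  have hrep := TensorRepresents.symmPart ⟨hs, hsg⟩ fun φ hφ x => (hg φ hφ x).1
  refine ⟨_, hrep, ?_⟩
  have hev : ∀ᶠ ε in toZero, IsPseudoRiemannianOn (symmPart (s ε)) (closure V) j := by
    -- The property passes to subsets and finite unions, so compactness reduces it to a compact
    -- neighbourhood of each point inside a chart domain.
    refine hVc.induction_on (p := fun S => ∀ᶠ ε in toZero,
      IsPseudoRiemannianOn (symmPart (s ε)) S j) ?_ ?_ ?_ ?_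
    · exact Filter.Eventually.of_forall fun ε p hp => hp.elim
    · exact fun S S' hSS' hS' => hS'.mono fun ε hε p hp => hε p (hSS' hp)
    · intro S S' hS hS'
      filter_upwards [hS, hS'] with ε h1 h2 p hp
      exact hp.elim (h1 p) (h2 p)
    · intro p _
      have hφ := IsManifold.chart_mem_maximalAtlas (I := 𝓡 n) (n := ∞) p
      set φ := chartAt (EuclideanSpace ℝ (Fin n)) p
      obtain ⟨N, hN, hNφ, hNc⟩ := local_compact_nhds
        (φ.open_source.mem_nhds (mem_chart_source (EuclideanSpace ℝ (Fin n)) p))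
      refine ⟨N, mem_nhdsWithin_of_mem_nhds hN, ?_⟩
      have hK : φ '' N ⊆ φ.target := by
        rintro _ ⟨q, hq, rfl⟩
        exact φ.map_source (hNφ hq)
      refine (eventually_isPseudoRiemannianOn_image hrep
        (fun ε p => formAt_symmPart_isSymm (s ε) p) hφ (h φ hφ) hK
        (hNc.image_of_continuousOn (φ.continuousOn.mono hNφ))).mono fun ε hε q hq => ?_
      exact hε q ⟨φ q, ⟨q, hq, rfl⟩, φ.left_inv (hNφ hq)⟩
  obtain ⟨δ, hδ, hδV⟩ := eventually_toZero_iff.1 hev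
  exact ⟨δ, hδ, fun ε hε p hp => hδV ε hε p (subset_closure hp)⟩

end Charts

end Colombeau

end

theorem mainTheorem8 (n : ℕ) {X : Type*} [TopologicalSpace X] [T2Space X] [ParacompactSpace X]
    [ChartedSpace (EuclideanSpace ℝ (Fin n)) X] [IsManifold (𝓡 n) ∞ X]
    (g : Colombeau.GenTensor n X) (hg : Colombeau.IsSymmNondegenerate g) (j : ℕ) :
    Colombeau.TensorHasIndex g j ↔
      ∀ (φ : OpenPartialHomeomorph X (EuclideanSpace ℝ (Fin n)))
        (hφ : φ ∈ IsManifold.maximalAtlas (𝓡 n) ∞ X) (x : Colombeau.GenPoint φ.target),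
        Colombeau.FormHasIndex (Colombeau.evalForm g φ hφ x) j := by
  exact ⟨fun h φ hφ x => h.formHasIndex hφ x (hg φ hφ x),
    fun h => Colombeau.tensorHasIndex_of_formHasIndex hg h⟩
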